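/- Let $W=(W_s)_{s\ge 0}$ be a standard Brownian motion on a probability space $(\Omega,\mathcal F,\mathsf P)$, and let $(\mathcal F_s)_{s\ge 0}$ be the filtration generated by $W$ and augmented with the $\mathsf P$-null sets. For $t\in[0,1)$ and $x\in\mathbb R$ let $X^{t,x}$ be the Brownian bridge started from $x$ at time $t$ and pinned at $0$ at time $1$, $$X^{t,x}_s=(1-s)\Big(\frac{x}{1-t}+\int_t^s\frac{\mathrm dW_u}{1-u}\Big),\quad s\in[t,1),\qquad X^{t,x}_1=0,$$ that is, the solution of $\mathrm dX_s=-\frac{X_s}{1-s}\,\mathrm ds+\mathrm dW_s$ on $[t,1)$ with $X_t=x$; for $t=1$ put $X^{1,x}_1=x$. Let $$v(t,x)=\sup_{0\le\tau\le 1-t}\mathsf E\big[e^{X^{t,x}_{t+\tau}}\big],\qquad (t,x)\in[0,1]\times\mathbb R,$$ where the supremum is over all random times $\tau\in[0,1-t]$ such that $t+\tau$ is an $(\mathcal F_s)$-stopping time. Let $S_1=\sup_{0\le s\le 1}|W_s|$ and $c_2=\mathsf E[S_1e^{S_1}]$. Then $0<c_2<\infty$, every expectation in the definition of $v$ is finite,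 $v$ is finite on $[0,1]\times\mathbb R$, and $v(1,x)=e^x$ for all $x\in\mathbb R$. For any $T<1$ and any $0\le t_1<t_2\le T$, $$|v(t_2,x)-v(t_1,x)|\le\frac{c_2e^{|x|}}{2\sqrt{1-T}}\,(t_2-t_1),\qquad x\in\mathbb R;$$ in particular, $v$ is locally Lipschitz in time on $[0,1)\times\mathbb R$. Moreover, as $t\uparrow 1$, $$\lim_{t\to1}v(t,x)=e^x\ \text{ for } x\ge 0,\qquad \liminf_{t\to1}v(t,x)\ge 1>e^x\ \text{ for } x<0,$$ so that, for each $x<0$, the function $t\mapsto v(t,x)$ on $[0,1]$ is discontinuous at $t=1$. -/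

import Mathlib

open MeasureTheory ProbabilityTheory Filter Topology
open scoped NNReal

noncomputable section

namespace BridgeStopping

variable {Ω : Type*} [mΩ : MeasurableSpace Ω]

/-- The `σ`-algebra generated by the `P`-null events. -/
abbrev nullSigma (P : Measure Ω) : MeasurableSpace Ω :=
  MeasurableSpace.generateFrom {A : Set Ω | MeasurableSet A ∧ P A = 0}

theorem nullSigma_le (P : Measure Ω) : nullSigma P ≤ mΩ :=
  MeasurableSpace.generateFrom_le fun _ hA => hA.1

/-- The filtration generated by `W`, augmented with the `P`-null events. -/
def augFiltration (P : Measure Ω) (W : ℝ≥0 → Ω → ℝ) (hWm : ∀ t, Measurable (W t)) :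
    Filtration ℝ≥0 mΩ :=
  Filtration.natural W (fun t => (hWm t).stronglyMeasurable) ⊔
    Filtration.const ℝ≥0 (nullSigma P) (nullSigma_le P)

/-- The Wiener integral `∫_t^s dW_u / (1 - u)` for `t ≤ s < 1`. Since the integrand is continuously
differentiable, it is the pathwise Riemann-Stieltjes integral, given by integration by parts. -/
def wienerIntegral (W : ℝ≥0 → Ω → ℝ) (t s : ℝ≥0) (ω : Ω) : ℝ :=
  W s ω / (1 - (s : ℝ)) - W t ω / (1 - (t : ℝ))
    - ∫ u in (t : ℝ)..(s : ℝ), W u.toNNReal ω / (1 - u) ^ 2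

/-- The Brownian bridge `X^{t,x}_s`, `t ≤ s ≤ 1`, started from `x` at time `t` and pinned at `0` at
time `1`, i.e. the solution of `dX_s = - X_s / (1 - s) ds + dW_s`, `X_t = x`. For `t < 1` the second
branch is `0` at `s = 1`; the first branch gives the initial condition, also for `t = 1`. -/
def bridge (W : ℝ≥0 → Ω → ℝ) (t : ℝ≥0) (x : ℝ) (s : ℝ≥0) (ω : Ω) : ℝ :=
  if s ≤ t then x
  else (1 - (s : ℝ)) * (x / (1 - (t : ℝ)) + wienerIntegral W t s ω)

/-- Random times `τ` with `0 ≤ τ ≤ 1 - t` such that `t + τ` is a stopping time. -/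
def IsAdmissible (P : Measure Ω) (W : ℝ≥0 → Ω → ℝ) (hWm : ∀ t, Measurable (W t))
    (t : ℝ≥0) (τ : Ω → ℝ≥0) : Prop :=
  (∀ ω, t + τ ω ≤ 1) ∧
    IsStoppingTime (augFiltration P W hWm) (fun ω => ((t + τ ω : ℝ≥0) : WithTop ℝ≥0))

/-- The payoff `exp (X^{t,x}_{t+τ})`. -/
def payoff (W : ℝ≥0 → Ω → ℝ) (t : ℝ≥0) (x : ℝ) (τ : Ω → ℝ≥0) (ω : Ω) : ℝ :=
  Real.exp (bridge W t x (t + τ ω) ω)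

/-- The set of expected payoffs of all admissible times. -/
def expectedPayoffs (P : Measure Ω) (W : ℝ≥0 → Ω → ℝ) (hWm : ∀ t, Measurable (W t))
    (t : ℝ≥0) (x : ℝ) : Set ℝ :=
  {r | ∃ τ : Ω → ℝ≥0, IsAdmissible P W hWm t τ ∧ r = ∫ ω, payoff W t x τ ω ∂P}

/-- The value function `v(t,x)`, for `t ∈ [0,1]`. -/
def value (P : Measure Ω) (W : ℝ≥0 → Ω → ℝ) (hWm : ∀ t, Measurable (W t))
    (t : ℝ≥0) (x : ℝ) : ℝ :=
  sSup (expectedPayoffs P W hWm t x)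

/-- `S_1 = sup_{0 ≤ s ≤ 1} |W_s|`. -/
def runningSup (W : ℝ≥0 → Ω → ℝ) (ω : Ω) : ℝ :=
  ⨆ s : Set.Iic (1 : ℝ≥0), |W s ω|

/-- `c_2 = E[S_1 exp(S_1)]`. -/
def c2 (P : Measure Ω) (W : ℝ≥0 → Ω → ℝ) : ℝ :=
  ∫ ω, runningSup W ω * Real.exp (runningSup W ω) ∂P

end BridgeStopping

end

/-! The value depends on `t` only through the volatility `c = √(1 - t)`. Run at relative time `r =
(s - t)/(1 - t)`, the bridge `X^{t,x}` has the law of `x (1 - r) + c Y_r`, with `Y` a standard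
bridge on `[0,1]`. The estimate in `t` thus becomes one in `c`.

Stopping times belong to a filtration and cannot simply be carried from one process to another, so
the comparison is made on grids. For a Markov chain with given Gaussian transitions, the optimal
stopping value is given by the backward recursion `snell`, whatever the filtration
(`IsGaussianChain.lintegral_le_snell`, `IsGaussianChain.exists_stopping`). Two chains share these
transitions: the pinned bridge in the augmented filtration (`exists_chain_bridge`) and `x (1 - r) +
c (W_r - r W_1)` in its own (`isGaussianChain_sampledBridge`). Rounding a stopping time up to the
grid and applying Fatou's lemma identifies `v(t,x)` with the supremum of the grid values
(`isLUB_expectedPayoffs`).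

For two volatilities `c` and `d`, the rule that is optimal for `c` is used for `d` on the same path.
The tangent-line bound for `exp` makes the loss at most `|c - d| e^{|x|} |Y| e^{|Y|}`, evaluated at
the stopping time. To dominate its expectation by `c_2`, write `Y_r` as the midpoint of `W_r` and
`W_r - 2 r W_1`. Both are Brownian motions and `a ↦ |a| e^{|a|}` is convex, so the expected grid
maximum for `Y` is at most that for `W`. Finiteness of `c_2` follows from a maximal inequality for
`exp (4 W) + exp (-4 W)`.

Since `√(1 - t)` has slope at most `1 / (2 √(1 - T))` in absolute value on `[0, T]`, the Lipschitz
bound follows. Comparison with `d = 0` gives `v ≤ e^{|x|} (1 + c c_2)`, hence the limit for `x ≥ 0`.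
Waiting until time `1` earns exactly `1`, hence the jump for `x < 0`. -/

namespace BridgeStopping

open scoped ENNReal

/-! ### Optimal stopping of Gaussian Markov chains by backward recursion. -/

section Chain

variable {Ω : Type*} {mΩ : MeasurableSpace Ω} {P : Measure Ω}

/-- The one-step transition operator of the chain `X ↦ a X + N`, `N ∼ 𝒩(0, q)`. -/
noncomputable def gaussStep (a : ℝ) (q : ℝ≥0) (h : ℝ → ℝ≥0∞) (x : ℝ) : ℝ≥0∞ :=
  ∫⁻ y, h (a * x + y) ∂gaussianReal 0 q

theorem measurable_gaussStep (a : ℝ) (q : ℝ≥0) {h : ℝ → ℝ≥0∞} (hh : Measurable h) :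
    Measurable (gaussStep a q h) := by
  unfold gaussStep
  exact Measurable.lintegral_prod_right' (f := fun p : ℝ × ℝ => h (a * p.1 + p.2)) (by fun_prop)

theorem gaussStep_mono (a : ℝ) (q : ℝ≥0) {h h' : ℝ → ℝ≥0∞} (hh : h ≤ h') :
    gaussStep a q h ≤ gaussStep a q h' :=
  fun _ => lintegral_mono fun _ => hh _

/-- The value of the optimal stopping problem with reward `g`, at time `k` with `m` steps left. -/
noncomputable def snell (g : ℝ → ℝ≥0∞) (a : ℕ → ℝ) (q : ℕ → ℝ≥0) : ℕ → ℕ → ℝ → ℝ≥0∞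
  | _, 0 => g
  | k, m + 1 => fun x => max (g x) (gaussStep (a k) (q k) (snell g a q (k + 1) m) x)

theorem measurable_snell {g : ℝ → ℝ≥0∞} (hg : Measurable g) (a : ℕ → ℝ) (q : ℕ → ℝ≥0) (k m : ℕ) :
    Measurable (snell g a q k m) := by
  induction m generalizing k with
  | zero => exact hg
  | succ m ih => exact hg.max (measurable_gaussStep _ _ (ih _))

theorem le_snell (g : ℝ → ℝ≥0∞) (a : ℕ → ℝ) (q : ℕ → ℝ≥0) (k m : ℕ) (x : ℝ) :
    g x ≤ snell g a q k m x := by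
  cases m with
  | zero => exact le_rfl
  | succ m => exact le_max_left _ _

/-- `X` is, up to time `n`, a Markov chain relative to `𝓖` with transition operators
`gaussStep (a k) (q k)`. -/
structure IsGaussianChain (P : Measure Ω) (𝓖 : Filtration ℕ mΩ) (a : ℕ → ℝ) (q : ℕ → ℝ≥0)
    (n : ℕ) (X : ℕ → Ω → ℝ) : Prop where
  meas : ∀ k ≤ n, Measurable[𝓖 k] (X k)
  step : ∀ k < n, ∀ A, MeasurableSet[𝓖 k] A → ∀ h : ℝ → ℝ≥0∞, Measurable h →
    ∫⁻ ω in A, h (X (k + 1) ω) ∂P = ∫⁻ ω in A, gaussStep (a k) (q k) h (X k ω) ∂P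

/-- Stopping times of a discrete filtration. -/
def IsDiscreteStopping (𝓖 : Filtration ℕ mΩ) (σ : Ω → ℕ) : Prop :=
  ∀ j, MeasurableSet[𝓖 j] {ω | σ ω ≤ j}

theorem IsDiscreteStopping.measurable {𝓖 : Filtration ℕ mΩ} {σ : Ω → ℕ}
    (h : IsDiscreteStopping 𝓖 σ) : Measurable σ :=
  measurable_of_Iic fun j => 𝓖.le j _ (h j)

theorem measurable_indicator_prodMk {Ω : Type*} [MeasurableSpace Ω] {A : Set Ω}
    (hA : MeasurableSet A) {X : Ω → ℝ} (hX : Measurable X) :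
    Measurable fun ω => (A.indicator (1 : Ω → ℝ≥0∞) ω, X ω) :=
  (measurable_one.indicator hA).prodMk hX

/-- The one-step Markov property, when the innovation `N` is independent of the past. -/
theorem lintegral_gaussStep_of_indep {Ω : Type*} {m mΩ : MeasurableSpace Ω} {P : Measure Ω}
    [IsProbabilityMeasure P] (hm : m ≤ mΩ)
    {X X' N : Ω → ℝ} {a : ℝ} {q : ℝ≥0} (hX : Measurable[m] X)
    (hN : HasLaw N (gaussianReal 0 q) P)
    (hind : ∀ Z : Ω → ℝ≥0∞ × ℝ, Measurable[m] Z → IndepFun Z N P)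
    (hX' : X' =ᵐ[P] fun ω => a * X ω + N ω) {A : Set Ω} (hA : MeasurableSet[m] A)
    {h : ℝ → ℝ≥0∞} (hh : Measurable h) :
    ∫⁻ ω in A, h (X' ω) ∂P = ∫⁻ ω in A, gaussStep a q h (X ω) ∂P := by
  -- Carrying the indicator of `A` along with `X` turns integration over `A` into the expectation of
  -- one function of `(Z, N)`, to which the product law applies.
  set Z : Ω → ℝ≥0∞ × ℝ := fun ω => (A.indicator 1 ω, X ω) with hZ
  have hZm : Measurable[m] Z :=
    @measurable_indicator_prodMk _ m _ hA _ hX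
  have hZ' : Measurable Z := hZm.mono hm le_rfl
  have key := (indepFun_iff_map_prod_eq_prod_map_map hZ'.aemeasurable hN.aemeasurable).1
    (hind Z hZm)
  have hF : Measurable fun p : (ℝ≥0∞ × ℝ) × ℝ => p.1.1 * h (a * p.1.2 + p.2) := by fun_prop
  have e1 : ∫⁻ ω in A, h (X' ω) ∂P = ∫⁻ ω, (Z ω).1 * h (a * (Z ω).2 + N ω) ∂P := by
    rw [← lintegral_indicator (hm _ hA)]
    refine lintegral_congr_ae ?_
    filter_upwards [hX'] with ω hω
    by_cases hωA : ω ∈ A <;> simp [hZ, hωA, hω]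
  have e2 : ∫⁻ ω in A, gaussStep a q h (X ω) ∂P
      = ∫⁻ ω, (Z ω).1 * gaussStep a q h (Z ω).2 ∂P := by
    rw [← lintegral_indicator (hm _ hA)]
    refine lintegral_congr fun ω => ?_
    by_cases hωA : ω ∈ A <;> simp [hZ, hωA]
  rw [e1, e2, ← lintegral_map' (f := fun p : (ℝ≥0∞ × ℝ) × ℝ => p.1.1 * h (a * p.1.2 + p.2))
    (g := fun ω => (Z ω, N ω)) hF.aemeasurable (hZ'.aemeasurable.prodMk hN.aemeasurable), key,
    hN.map_eq, lintegral_prod _ hF.aemeasurable,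
    lintegral_map (hF.lintegral_prod_right') hZ']
  refine lintegral_congr fun ω => ?_
  rw [gaussStep, lintegral_const_mul _ (by fun_prop)]

variable {𝓖 : Filtration ℕ mΩ} {a : ℕ → ℝ} {q : ℕ → ℝ≥0} {n : ℕ} {X : ℕ → Ω → ℝ}

theorem IsGaussianChain.measurable (hX : IsGaussianChain P 𝓖 a q n X) {k : ℕ} (hk : k ≤ n) :
    Measurable (X k) :=
  (hX.meas k hk).mono (𝓖.le k) le_rfl

/-- Induction on the steps left. On `{σ ≤ k}` the rule stops now and earns `g`; on the rest, an
event of `𝓖 k`, the Markov property trades the next value for `gaussStep`. Quantifying over events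
`A` replaces conditional expectations. -/
theorem IsGaussianChain.setLIntegral_le_snell (hX : IsGaussianChain P 𝓖 a q n X)
    {g : ℝ → ℝ≥0∞} (hg : Measurable g) {σ : Ω → ℕ} (hσ : IsDiscreteStopping 𝓖 σ) (m : ℕ) :
    ∀ k, k + m = n → ∀ A, MeasurableSet[𝓖 k] A → (∀ ω ∈ A, k ≤ σ ω ∧ σ ω ≤ n) →
      ∫⁻ ω in A, g (X (σ ω) ω) ∂P ≤ ∫⁻ ω in A, snell g a q k m (X k ω) ∂P := by
  induction m with
  | zero =>
    intro k hk A hA h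
    refine setLIntegral_mono_ae' (𝓖.le k _ hA) (ae_of_all _ fun ω hω => ?_)
    have : σ ω = k := by have := h ω hω; omega
    rw [this]; exact le_rfl
  | succ m ih =>
    intro k hk A hA h
    have hs : MeasurableSet[𝓖 k] {ω | σ ω ≤ k} := hσ k
    rw [← lintegral_inter_add_sdiff _ A (𝓖.le k _ hs),
      ← lintegral_inter_add_sdiff (fun ω => snell g a q k (m + 1) (X k ω)) A (𝓖.le k _ hs)]
    refine add_le_add ?_ ?_
    · refine setLIntegral_mono_ae' (𝓖.le k _ (hA.inter hs)) (ae_of_all _ fun ω hω => ?_)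
      have : σ ω = k := le_antisymm hω.2 (h ω hω.1).1
      rw [this]; exact le_snell ..
    · have hD : MeasurableSet[𝓖 k] (A \ {ω | σ ω ≤ k}) := hA.diff hs
      refine (ih (k + 1) (by omega) _ (𝓖.mono k.le_succ _ hD) fun ω hω => ?_).trans ?_
      · have := hω.2
        simp only [Set.mem_ofPred_eq] at this
        exact ⟨by omega, (h ω hω.1).2⟩
      · rw [hX.step k (by omega) _ hD _ (measurable_snell hg ..)]
        exact lintegral_mono fun ω => le_max_right _ _

theorem IsGaussianChain.lintegral_le_snell (hX : IsGaussianChain P 𝓖 a q n X)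
    {g : ℝ → ℝ≥0∞} (hg : Measurable g) {σ : Ω → ℕ} (hσ : IsDiscreteStopping 𝓖 σ)
    (hσn : ∀ ω, σ ω ≤ n) :
    ∫⁻ ω, g (X (σ ω) ω) ∂P ≤ ∫⁻ ω, snell g a q 0 n (X 0 ω) ∂P := by
  simpa using hX.setLIntegral_le_snell hg hσ n 0 (by simp) Set.univ MeasurableSet.univ
    fun ω _ => ⟨Nat.zero_le _, hσn ω⟩

/-- The optimal rule stops as soon as the reward is at least the value of continuing. -/
theorem IsGaussianChain.exists_stopping_from (hX : IsGaussianChain P 𝓖 a q n X)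
    {g : ℝ → ℝ≥0∞} (hg : Measurable g) (m : ℕ) :
    ∀ k, k + m = n → ∃ σ : Ω → ℕ, IsDiscreteStopping 𝓖 σ ∧ (∀ ω, k ≤ σ ω ∧ σ ω ≤ n) ∧
      ∀ A, MeasurableSet[𝓖 k] A →
        ∫⁻ ω in A, snell g a q k m (X k ω) ∂P ≤ ∫⁻ ω in A, g (X (σ ω) ω) ∂P := by
  classical
  induction m with
  | zero =>
    intro k hk
    exact ⟨fun _ => k, fun j => @MeasurableSet.const _ (𝓖 j) _, fun ω => ⟨le_rfl, by simp; omega⟩,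
      fun A hA => le_rfl⟩
  | succ m ih =>
    intro k hk
    obtain ⟨σ, hσ, hσk, hσA⟩ := ih (k + 1) (by omega)
    set B : Set Ω := {ω | gaussStep (a k) (q k) (snell g a q (k + 1) m) (X k ω) ≤ g (X k ω)} with hB
    have hXk := hX.meas k (by omega)
    have hBm : MeasurableSet[𝓖 k] B :=
      measurableSet_le ((measurable_gaussStep _ _ (measurable_snell hg ..)).comp hXk)
        (hg.comp hXk)
    refine ⟨fun ω => if ω ∈ B then k else σ ω, fun j => ?_, fun ω => ?_, fun A hA => ?_⟩
    · rcases lt_or_ge j k with hj | hj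
      · have : {ω | (if ω ∈ B then k else σ ω) ≤ j} = ∅ := by
          ext ω
          have := hσk ω
          simp only [Set.mem_ofPred_eq, Set.mem_empty_iff_false, iff_false]
          split_ifs <;> omega
        rw [this]; exact @MeasurableSet.empty _ (𝓖 j)
      · have : {ω | (if ω ∈ B then k else σ ω) ≤ j} = B ∪ {ω | σ ω ≤ j} := by
          ext ω
          by_cases hω : ω ∈ B <;> simp [hω, hj]
        rw [this]; exact @MeasurableSet.union _ (𝓖 j) B _ (𝓖.mono hj _ hBm) (hσ j)
    · have := hσk ω
      dsimp only
      split_ifs <;> omega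
    · rw [← lintegral_inter_add_sdiff _ A (𝓖.le k _ hBm),
        ← lintegral_inter_add_sdiff (fun ω => g (X (if ω ∈ B then k else σ ω) ω)) A
          (𝓖.le k _ hBm)]
      refine add_le_add ?_ ?_
      · refine setLIntegral_mono_ae' (𝓖.le k _ (hA.inter hBm)) (ae_of_all _ fun ω hω => ?_)
        rw [if_pos hω.2]
        exact max_le le_rfl hω.2
      · have hD : MeasurableSet[𝓖 k] (A \ B) := hA.diff hBm
        have e1 : ∫⁻ ω in A \ B, g (X (if ω ∈ B then k else σ ω) ω) ∂P
            = ∫⁻ ω in A \ B, g (X (σ ω) ω) ∂P :=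
          setLIntegral_congr_fun (𝓖.le k _ hD) fun ω hω => by simp only [if_neg hω.2]
        rw [e1]
        refine le_trans ?_ (hσA _ (𝓖.mono k.le_succ _ hD))
        rw [hX.step k (by omega) _ hD _ (measurable_snell hg ..)]
        refine setLIntegral_mono_ae' (𝓖.le k _ hD) (ae_of_all _ fun ω hω => ?_)
        exact max_le (not_le.1 hω.2).le le_rfl

theorem IsGaussianChain.exists_stopping (hX : IsGaussianChain P 𝓖 a q n X)
    {g : ℝ → ℝ≥0∞} (hg : Measurable g) :
    ∃ σ : Ω → ℕ, IsDiscreteStopping 𝓖 σ ∧ (∀ ω, σ ω ≤ n) ∧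
      ∫⁻ ω, snell g a q 0 n (X 0 ω) ∂P ≤ ∫⁻ ω, g (X (σ ω) ω) ∂P := by
  obtain ⟨σ, h1, h2, h3⟩ := hX.exists_stopping_from hg n 0 (by simp)
  exact ⟨σ, h1, fun ω => (h2 ω).2, by simpa using h3 Set.univ MeasurableSet.univ⟩

/-- A maximal inequality: the chance of reaching a level of the reward. -/
theorem IsGaussianChain.maximal_le (hX : IsGaussianChain P 𝓖 a q n X)
    {g : ℝ → ℝ≥0∞} (hg : Measurable g) (L : ℝ≥0∞) :
    L * P {ω | ∃ k ≤ n, L ≤ g (X k ω)} ≤ ∫⁻ ω, snell g a q 0 n (X 0 ω) ∂P := by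
  classical
  -- First time the level is reached, with `n` as default when it never is. The default is why `j <
  -- n` and `n ≤ j` are treated apart below.
  set σ : Ω → ℕ := fun ω => if h : ∃ k ≤ n, L ≤ g (X k ω) then Nat.find h else n with hσdef
  have hσn : ∀ ω, σ ω ≤ n := fun ω => by
    simp only [hσdef]
    split_ifs with h
    · exact (Nat.find_spec h).1
    · exact le_rfl
  have hσ : IsDiscreteStopping 𝓖 σ := fun j => by
    rcases le_or_gt n j with hj | hj
    · have : {ω | σ ω ≤ j} = Set.univ := Set.eq_univ_of_forall fun ω => (hσn ω).trans hj
      rw [this]; exact MeasurableSet.univ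
    · have : {ω | σ ω ≤ j} = ⋃ k ∈ Finset.range (j + 1), {ω | L ≤ g (X k ω)} := by
        ext ω
        simp only [hσdef, Set.mem_ofPred_eq, Set.mem_iUnion, Finset.mem_range, exists_prop]
        split_ifs with h
        · rw [Nat.find_le_iff]
          constructor
          · rintro ⟨k, h1, h2, h3⟩; exact ⟨k, by omega, h3⟩
          · rintro ⟨k, h1, h3⟩; exact ⟨k, by omega, by omega, h3⟩
        · constructor
          · intro h'; omega
          · rintro ⟨k, h1, h3⟩; exact absurd ⟨k, by omega, h3⟩ h
      rw [this]
      refine Finset.measurableSet_biUnion _ fun k hk => ?_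
      rw [Finset.mem_range] at hk
      exact 𝓖.mono (by omega) _
        (measurableSet_le measurable_const (hg.comp (hX.meas k (by omega))))
  refine le_trans ?_ (hX.lintegral_le_snell hg hσ hσn)
  have hms : MeasurableSet {ω | ∃ k ≤ n, L ≤ g (X k ω)} := by
    have : {ω | ∃ k ≤ n, L ≤ g (X k ω)} = ⋃ k ∈ Finset.range (n + 1), {ω | L ≤ g (X k ω)} := by
      ext ω; simp
    rw [this]
    refine Finset.measurableSet_biUnion _ fun k hk => ?_
    rw [Finset.mem_range] at hk
    exact measurableSet_le measurable_const (hg.comp (hX.measurable (by omega)))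
  rw [← setLIntegral_const]
  refine le_trans ?_ (setLIntegral_le_lintegral {ω | ∃ k ≤ n, L ≤ g (X k ω)} _)
  refine setLIntegral_mono_ae' hms (ae_of_all _ fun ω hω => ?_)
  have hω' : ∃ k ≤ n, L ≤ g (X k ω) := hω
  simp only [hσdef, dif_pos hω']
  exact (Nat.find_spec hω').2

end Chain

/-! ### The standard bridge `W_r - r W_1` as a Gaussian Markov chain. -/

section Gaussian

variable {Ω : Type*} {mΩ : MeasurableSpace Ω} {P : Measure Ω}

/-- A family of linear combinations of a Gaussian process is a Gaussian process. -/
theorem isGaussianProcess_of_mem_span {S T : Type*} {B : T → Ω → ℝ} {Y : S → Ω → ℝ}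
    (hB : IsGaussianProcess B P) (hY : ∀ s, Y s ∈ Submodule.span ℝ (Set.range B)) :
    IsGaussianProcess Y P := by
  refine hB.of_isGaussianProcess fun s => ?_
  obtain ⟨c, hc⟩ := Finsupp.mem_span_range_iff_exists_finsupp.1 (hY s)
  refine ⟨c.support, ∑ i : c.support, c i • ContinuousLinearMap.proj i, fun ω => ?_⟩
  rw [← hc, Finsupp.sum, Finset.sum_apply, ← Finset.sum_coe_sort]
  simp

theorem mem_span_eval {T : Type*} (B : T → Ω → ℝ) (t : T) :
    B t ∈ Submodule.span ℝ (Set.range B) :=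
  Submodule.subset_span ⟨t, rfl⟩

theorem integral_eq_zero_of_mem_span {W : ℝ≥0 → Ω → ℝ} (hW : IsPreBrownianReal W P) {Z : Ω → ℝ}
    (hZ : Z ∈ Submodule.span ℝ (Set.range W)) : ∫ ω, Z ω ∂P = 0 := by
  obtain ⟨c, hc⟩ := Finsupp.mem_span_range_iff_exists_finsupp.1 hZ
  rw [← hc, Finsupp.sum]
  simp only [Finset.sum_apply, Pi.smul_apply, smul_eq_mul]
  rw [integral_finsetSum _ fun i _ => (hW.integrable_eval i).const_mul _]
  refine Finset.sum_eq_zero fun i _ => ?_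
  rw [integral_const_mul, hW.integral_eval, mul_zero]

theorem hasGaussianLaw_of_mem_span {W : ℝ≥0 → Ω → ℝ} (hW : IsPreBrownianReal W P) {Z : Ω → ℝ}
    (hZ : Z ∈ Submodule.span ℝ (Set.range W)) : HasGaussianLaw Z P :=
  (isGaussianProcess_of_mem_span (Y := fun _ : Unit => Z) hW.isGaussianProcess
    fun _ => hZ).hasGaussianLaw_eval ()

theorem hasLaw_of_mem_span {W : ℝ≥0 → Ω → ℝ} (hW : IsPreBrownianReal W P) {Z : Ω → ℝ}
    (hZ : Z ∈ Submodule.span ℝ (Set.range W)) :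
    HasLaw Z (gaussianReal 0 Var[Z; P].toNNReal) P := by
  have h := hasGaussianLaw_of_mem_span hW hZ
  exact ⟨h.aemeasurable, by rw [h.map_eq_gaussianReal, integral_eq_zero_of_mem_span hW hZ]⟩

theorem covariance_sub_mul {X₁ X₂ Y₁ Y₂ : Ω → ℝ} [IsFiniteMeasure P] (hX₁ : MemLp X₁ 2 P)
    (hX₂ : MemLp X₂ 2 P) (hY₁ : MemLp Y₁ 2 P) (hY₂ : MemLp Y₂ 2 P) (α β : ℝ) :
    cov[fun ω => X₁ ω - α * X₂ ω, fun ω => Y₁ ω - β * Y₂ ω; P] =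
      cov[X₁, Y₁; P] - β * cov[X₁, Y₂; P] - α * cov[X₂, Y₁; P] + α * β * cov[X₂, Y₂; P] := by
  have e1 : (fun ω => X₁ ω - α * X₂ ω) = X₁ - α • X₂ := rfl
  have e2 : (fun ω => Y₁ ω - β * Y₂ ω) = Y₁ - β • Y₂ := rfl
  rw [e1, e2, covariance_sub_left hX₁ (hX₂.const_smul α) (hY₁.sub (hY₂.const_smul β)),
    covariance_sub_right hX₁ hY₁ (hY₂.const_smul β),
    covariance_sub_right (hX₂.const_smul α) hY₁ (hY₂.const_smul β),
    covariance_smul_left, covariance_smul_right, covariance_smul_left, covariance_smul_right]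
  ring

theorem indepFun_of_measurable {Ω : Type*} {m mΩ : MeasurableSpace Ω} {P : Measure Ω}
    {β : Type*} [MeasurableSpace β] {Z : Ω → β} {N : Ω → ℝ}
    (h : Indep m (MeasurableSpace.comap N inferInstance) P) (hZ : Measurable[m] Z) :
    IndepFun Z N P :=
  indep_of_indep_of_le_left h hZ.comap_le

/-- The standard Brownian bridge on `[0,1]`, as a linear functional of the path. -/
def tiedDown (W : ℝ≥0 → Ω → ℝ) (r : ℝ≥0) (ω : Ω) : ℝ := W r ω - r * W 1 ω

theorem tiedDown_mem_span (W : ℝ≥0 → Ω → ℝ) (r : ℝ≥0) :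
    tiedDown W r ∈ Submodule.span ℝ (Set.range W) :=
  Submodule.sub_mem _ (mem_span_eval W r) (Submodule.smul_mem _ (r : ℝ) (mem_span_eval W 1))

variable {W : ℝ≥0 → Ω → ℝ}

theorem memLp_of_mem_span (hW : IsPreBrownianReal W P) {Z : Ω → ℝ}
    (hZ : Z ∈ Submodule.span ℝ (Set.range W)) : MemLp Z 2 P :=
  (hasGaussianLaw_of_mem_span hW hZ).memLp_two

theorem covariance_tiedDown (hW : IsPreBrownianReal W P) {r s : ℝ≥0} (hr : r ≤ s) (hs : s ≤ 1) :
    cov[tiedDown W r, tiedDown W s; P] = r * (1 - s) := by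
  have := hW.isGaussianProcess.isProbabilityMeasure
  have h := fun t => memLp_of_mem_span hW (mem_span_eval W t)
  unfold tiedDown
  rw [covariance_sub_mul (h _) (h _) (h _) (h _)]
  simp only [hW.covariance_eval, min_eq_left hr, min_eq_left (hr.trans hs), min_eq_right hs,
    min_self]
  push_cast; ring

/-- The innovation of the Brownian bridge between times `r` and `r'`. -/
noncomputable def innovation (W : ℝ≥0 → Ω → ℝ) (r r' : ℝ≥0) (ω : Ω) : ℝ :=
  tiedDown W r' ω - (1 - (r' : ℝ)) / (1 - r) * tiedDown W r ω

theorem innovation_mem_span (W : ℝ≥0 → Ω → ℝ) (r r' : ℝ≥0) :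
    innovation W r r' ∈ Submodule.span ℝ (Set.range W) :=
  Submodule.sub_mem _ (tiedDown_mem_span W r') (Submodule.smul_mem _ _ (tiedDown_mem_span W r))

theorem hasLaw_innovation (hW : IsPreBrownianReal W P) {r r' : ℝ≥0} (hr : r ≤ r') (hr' : r' ≤ 1)
    (hr1 : r < 1) :
    HasLaw (innovation W r r')
      (gaussianReal 0 ((1 - (r' : ℝ)) * (r' - r) / (1 - r)).toNNReal) P := by
  have := hW.isGaussianProcess.isProbabilityMeasure
  have h := fun t => memLp_of_mem_span hW (tiedDown_mem_span W t)
  convert hasLaw_of_mem_span hW (innovation_mem_span W r r') using 3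
  rw [← covariance_self (hasGaussianLaw_of_mem_span hW (innovation_mem_span W r r')).aemeasurable]
  unfold innovation
  rw [covariance_sub_mul (h _) (h _) (h _) (h _), covariance_tiedDown hW le_rfl hr',
    covariance_tiedDown hW le_rfl hr1.le, covariance_comm, covariance_tiedDown hW hr hr']
  have : (1 : ℝ) - r ≠ 0 := by
    have : (r : ℝ) < 1 := by exact_mod_cast hr1
    linarith
  field_simp
  ring

/-- The coefficient `(1 - r') / (1 - r)` is the regression coefficient on the bridge at `r`, so the
innovation is uncorrelated with the bridge at every earlier time; for jointly Gaussian variables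
this is independence. -/
theorem indepFun_innovation (hW : IsPreBrownianReal W P) {r r' : ℝ≥0} (hr : r ≤ r') (hr' : r' ≤ 1)
    (hr1 : r < 1) {ι : Type*} {u : ι → ℝ≥0} (hu : ∀ i, u i ≤ r) :
    IndepFun (fun ω i => tiedDown W (u i) ω) (innovation W r r') P := by
  have := hW.isGaussianProcess.isProbabilityMeasure
  have h := fun t => memLp_of_mem_span hW (tiedDown_mem_span W t)
  have key : IndepFun (fun ω i => tiedDown W (u i) ω)
      (fun ω (_ : Unit) => innovation W r r' ω) P := by
    refine IsGaussianProcess.indepFun_of_covariance_eq_zero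
      (X := fun i => tiedDown W (u i)) (Y := fun _ : Unit => innovation W r r') ?_
      (fun i => (hasGaussianLaw_of_mem_span hW (tiedDown_mem_span W _)).aemeasurable)
      (fun _ => (hasGaussianLaw_of_mem_span hW (innovation_mem_span W _ _)).aemeasurable) ?_
    · refine isGaussianProcess_of_mem_span hW.isGaussianProcess ?_
      rintro (i | _)
      · exact tiedDown_mem_span W _
      · exact innovation_mem_span W _ _
    · rintro i -
      have e1 : innovation W r r' = tiedDown W r' - ((1 - (r' : ℝ)) / (1 - r)) • tiedDown W r := rfl
      rw [e1, covariance_sub_right (h _) (h _) ((h _).const_smul _), covariance_smul_right,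
        covariance_tiedDown hW ((hu i).trans hr) hr', covariance_tiedDown hW (hu i) hr1.le]
      have : (1 : ℝ) - r ≠ 0 := by
        have : (r : ℝ) < 1 := by exact_mod_cast hr1
        linarith
      field_simp
      ring
  exact key.comp (φ := id) (ψ := fun f : Unit → ℝ => f ()) measurable_id (measurable_pi_apply ())

/-- The autoregression coefficients of the Brownian bridge on the grid `k / n`. -/
noncomputable def bridgeCoef (n k : ℕ) : ℝ := (1 - (k + 1 : ℕ) / (n : ℝ)) / (1 - k / (n : ℝ))

/-- The innovation variances, with volatility `c`, of the Brownian bridge on the grid `k / n`. -/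
noncomputable def bridgeVar (c : ℝ≥0) (n k : ℕ) : ℝ≥0 :=
  c ^ 2 * ((1 - (k + 1 : ℕ) / (n : ℝ)) * ((k + 1 : ℕ) / (n : ℝ) - k / n) / (1 - k / n)).toNNReal

theorem grid_le_one {n k : ℕ} (hk : k ≤ n) : (k / n : ℝ≥0) ≤ 1 := by
  have : (k : ℝ≥0) ≤ n := by exact_mod_cast hk
  exact div_le_one_of_le₀ this (by positivity)

theorem grid_lt_one {n k : ℕ} (hk : k < n) : (k / n : ℝ≥0) < 1 := by
  have : (k : ℝ≥0) < n := by exact_mod_cast hk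
  exact (div_lt_one (pos_of_gt this)).2 this

theorem grid_mono (n : ℕ) {j k : ℕ} (hk : j ≤ k) : (j / n : ℝ≥0) ≤ k / n := by
  have : (j : ℝ≥0) ≤ k := by exact_mod_cast hk
  gcongr

/-- The bridge `x (1 - r) + c Y_r` sampled on the grid `k / n`. -/
noncomputable def sampledBridge (W : ℝ≥0 → Ω → ℝ) (c : ℝ≥0) (n : ℕ) (x : ℝ) (k : ℕ) (ω : Ω) : ℝ :=
  x * (1 - k / (n : ℝ)) + c * tiedDown W (k / n) ω

theorem measurable_tiedDown (hWm : ∀ t, Measurable (W t)) (r : ℝ≥0) : Measurable (tiedDown W r) :=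
  (hWm r).sub ((hWm 1).const_mul _)

/-- The filtration generated by the bridge on the grid `k / n`. -/
noncomputable def tiedDownFiltration (W : ℝ≥0 → Ω → ℝ) (hWm : ∀ t, Measurable (W t)) (n : ℕ) :
    Filtration ℕ mΩ :=
  Filtration.natural (fun k : ℕ => tiedDown W (k / n))
    fun _ => (measurable_tiedDown hWm _).stronglyMeasurable

/-- The drift `x (1 - k/n)` obeys the same recursion as the bridge, so `x` enters only through the
initial state and the transitions depend on `c` and `n` alone. -/
theorem isGaussianChain_sampledBridge (hW : IsPreBrownianReal W P) (hWm : ∀ t, Measurable (W t))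
    (c : ℝ≥0) (n : ℕ) (x : ℝ) :
    IsGaussianChain P (tiedDownFiltration W hWm n) (bridgeCoef n) (bridgeVar c n) n
      (sampledBridge W c n x) := by
  have := hW.isGaussianProcess.isProbabilityMeasure
  have hm : ∀ k, Measurable[tiedDownFiltration W hWm n k] (sampledBridge W c n x k) := fun k =>
    ((Filtration.stronglyAdapted_natural (u := fun k : ℕ => tiedDown W (k / n))
      fun _ => (measurable_tiedDown hWm _).stronglyMeasurable) k).measurable.const_mul _ |>.const_add _
  refine ⟨fun k _ => hm k, fun k hk A hA h hh => ?_⟩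
  have h1 := grid_mono n k.le_succ
  have h2 := grid_le_one (n := n) (k := k + 1) hk
  have h3 := grid_lt_one hk
  refine lintegral_gaussStep_of_indep ((tiedDownFiltration W hWm n).le k) (hm k)
    (N := fun ω => c * innovation W (k / n) ((k + 1 : ℕ) / n) ω) ?_ ?_ (ae_of_all _ fun ω => ?_)
    hA hh
  · have := gaussianReal_const_mul (hasLaw_innovation hW h1 h2 h3) c
    convert this using 2
    · simp
    · ext; simp [bridgeVar]
  · intro Z hZ
    refine indepFun_of_measurable ?_ hZ
    rw [tiedDownFiltration, Filtration.natural_eq_comap]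
    exact (indepFun_innovation hW h1 h2 h3 (u := fun j : Set.Iic k => (j / n : ℝ≥0))
      fun j => grid_mono n j.2).comp measurable_id (measurable_const_mul (c : ℝ))
  · have : (1 : ℝ) - k / n ≠ 0 := by
      have : ((k / n : ℝ≥0) : ℝ) < 1 := by exact_mod_cast h3
      push_cast at this
      linarith
    simp only [sampledBridge, innovation, bridgeCoef]
    push_cast
    field_simp
    ring

/-- The value of stopping the bridge with volatility `c`, started at `x`, on the grid `k / n`. -/
noncomputable def gridValue (c : ℝ≥0) (n : ℕ) (x : ℝ) : ℝ≥0∞ :=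
  snell (fun y => ENNReal.ofReal (Real.exp y)) (bridgeCoef n) (bridgeVar c n) 0 n x

theorem lintegral_snell_sampledBridge (hW : IsPreBrownianReal W P) (c : ℝ≥0) (n : ℕ) (x : ℝ) :
    ∫⁻ ω, snell (fun y => ENNReal.ofReal (Real.exp y)) (bridgeCoef n) (bridgeVar c n) 0 n
      (sampledBridge W c n x 0 ω) ∂P = gridValue c n x := by
  have := hW.isGaussianProcess.isProbabilityMeasure
  have : ∀ᵐ ω ∂P, sampledBridge W c n x 0 ω = x := by
    filter_upwards [hW.eval_zero_ae_eq_zero] with ω hω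
    simp [sampledBridge, tiedDown, hω]
  calc _ = ∫⁻ ω, gridValue c n x ∂P := lintegral_congr_ae (by
        filter_upwards [this] with ω hω; rw [hω]; rfl)
    _ = _ := by simp

end Gaussian

/-! ### Comparison of two volatilities, and domination of the bridge by the motion. -/

section MaximalBound

variable {Ω : Type*} {mΩ : MeasurableSpace Ω} {P : Measure Ω} {W : ℝ≥0 → Ω → ℝ}

/-- The function `a ↦ |a| exp |a|`. -/
noncomputable def absMulExp (a : ℝ) : ℝ := |a| * Real.exp |a|

theorem measurable_absMulExp : Measurable absMulExp := by unfold absMulExp; fun_prop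

theorem absMulExp_nonneg (a : ℝ) : 0 ≤ absMulExp a := by unfold absMulExp; positivity

theorem absMulExp_mono {a b : ℝ} (h : |a| ≤ |b|) : absMulExp a ≤ absMulExp b := by
  unfold absMulExp; gcongr

/-- Midpoint convexity: combine convexity of `exp` with Chebyshev's inequality for the increasing
functions `u` and `exp u`. -/
theorem absMulExp_half_add_le (a b : ℝ) :
    absMulExp ((a + b) / 2) ≤ absMulExp a / 2 + absMulExp b / 2 := by
  have h1 : absMulExp ((a + b) / 2) ≤ absMulExp ((|a| + |b|) / 2) := by
    apply absMulExp_mono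
    rw [abs_div, abs_div, abs_of_nonneg (by positivity : 0 ≤ |a| + |b|)]
    gcongr
    exact abs_add_le a b
  refine h1.trans ?_
  unfold absMulExp
  rw [abs_of_nonneg (by positivity : 0 ≤ (|a| + |b|) / 2)]
  have hu := abs_nonneg a
  have hv := abs_nonneg b
  generalize |a| = u at hu ⊢
  generalize |b| = v at hv ⊢
  have e1 : Real.exp ((u + v) / 2) ≤ (Real.exp u + Real.exp v) / 2 := by
    have : Real.exp ((u + v) / 2) = Real.exp (u / 2) * Real.exp (v / 2) := by
      rw [← Real.exp_add]; ring_nf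
    have h1 : Real.exp u = Real.exp (u / 2) * Real.exp (u / 2) := by
      rw [← Real.exp_add]; ring_nf
    have h2 : Real.exp v = Real.exp (v / 2) * Real.exp (v / 2) := by
      rw [← Real.exp_add]; ring_nf
    rw [this, h1, h2]
    nlinarith [sq_nonneg (Real.exp (u / 2) - Real.exp (v / 2))]
  have e2 : 0 ≤ (u - v) * (Real.exp u - Real.exp v) := by
    rcases le_total u v with h | h
    · exact mul_nonneg_of_nonpos_of_nonpos (by linarith) (sub_nonpos.2 (Real.exp_le_exp.2 h))
    · exact mul_nonneg (by linarith) (sub_nonneg.2 (Real.exp_le_exp.2 h))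
  nlinarith [mul_le_mul_of_nonneg_left e1 (by positivity : 0 ≤ (u + v) / 2)]

/-- The largest value of `|f i| exp |f i|` over `i ∈ I`. -/
noncomputable def supAbsMulExp (I : Finset ℝ≥0) (f : ℝ≥0 → ℝ) : ℝ≥0∞ :=
  ⨆ i : I, ENNReal.ofReal (absMulExp (f i))

theorem le_supAbsMulExp {I : Finset ℝ≥0} (f : ℝ≥0 → ℝ) {i : ℝ≥0} (hi : i ∈ I) :
    ENNReal.ofReal (absMulExp (f i)) ≤ supAbsMulExp I f :=
  le_iSup (fun i : I => ENNReal.ofReal (absMulExp (f i))) ⟨i, hi⟩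

/-- The right side involves only the finite-dimensional law, so the integral is the same for any two
Brownian motions. -/
theorem lintegral_supAbsMulExp (hW : IsPreBrownianReal W P) (I : Finset ℝ≥0) :
    ∫⁻ ω, supAbsMulExp I (W · ω) ∂P =
      ∫⁻ w, ⨆ i, ENNReal.ofReal (absMulExp (w i)) ∂BrownianReal.projectiveFamily I := by
  rw [← (hW.hasLaw I).map_eq, lintegral_map' _ (hW.hasLaw I).aemeasurable]
  · rfl
  · exact (Measurable.iSup fun i => (measurable_absMulExp.comp
      (measurable_pi_apply i)).ennreal_ofReal).aemeasurable

/-- The path reflected in its bridge: `W_r - 2 r W_1` for `r ≤ 1`. -/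
noncomputable def reflected (W : ℝ≥0 → Ω → ℝ) (r : ℝ≥0) (ω : Ω) : ℝ :=
  W r ω - (2 * min (r : ℝ) 1) * W 1 ω

/-- In `W_r = Y_r + r W_1` the bridge `Y` is independent of `W_1`, so the sign of `W_1` may be
flipped. The truncation at `1` keeps the covariance right for `r > 1` as well. -/
theorem isPreBrownianReal_reflected (hW : IsPreBrownianReal W P) :
    IsPreBrownianReal (reflected W) P := by
  have := hW.isGaussianProcess.isProbabilityMeasure
  have h := fun t => memLp_of_mem_span hW (mem_span_eval W t)
  have hs : ∀ r, reflected W r ∈ Submodule.span ℝ (Set.range W) := fun r =>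
    Submodule.sub_mem _ (mem_span_eval W r) (Submodule.smul_mem _ _ (mem_span_eval W 1))
  refine (isGaussianProcess_of_mem_span hW.isGaussianProcess hs).isPreBrownianReal_of_covariance
    (fun t => integral_eq_zero_of_mem_span hW (hs t)) fun s t hst => ?_
  unfold reflected
  rw [covariance_sub_mul (h _) (h _) (h _) (h _)]
  simp only [hW.covariance_eval, min_eq_left hst, min_self]
  rw [min_comm 1 t]
  push_cast
  have : (s : ℝ) ≤ t := hst
  rcases le_total (s : ℝ) 1 with h1 | h1 <;> rcases le_total (t : ℝ) 1 with h2 | h2 <;>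
    simp only [h1, h2, min_eq_left, min_eq_right] <;> ring

theorem lintegral_supAbsMulExp_tiedDown_le (hW : IsPreBrownianReal W P)
    (hWm : ∀ t, Measurable (W t)) {I : Finset ℝ≥0} (hI : ∀ i ∈ I, i ≤ 1) :
    ∫⁻ ω, supAbsMulExp I (tiedDown W · ω) ∂P ≤ ∫⁻ ω, supAbsMulExp I (W · ω) ∂P := by
  have hmeas : ∀ B : ℝ≥0 → Ω → ℝ, (∀ t, Measurable (B t)) →
      Measurable fun ω => supAbsMulExp I (B · ω) := fun B hB => by
    unfold supAbsMulExp
    exact Measurable.iSup fun i => (measurable_absMulExp.comp (hB _)).ennreal_ofReal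
  have hrm : ∀ t, Measurable (reflected W t) := fun t => (hWm t).sub ((hWm 1).const_mul _)
  have hpt : ∀ ω, supAbsMulExp I (tiedDown W · ω) ≤
      2⁻¹ * (supAbsMulExp I (W · ω) + supAbsMulExp I (reflected W · ω)) := fun ω => by
    refine iSup_le fun ⟨i, hi⟩ => ?_
    have e : tiedDown W i ω = (W i ω + reflected W i ω) / 2 := by
      have : (i : ℝ) ≤ 1 := hI i hi
      simp only [tiedDown, reflected, min_eq_left this]; ring
    have := absMulExp_half_add_le (W i ω) (reflected W i ω)
    calc ENNReal.ofReal (absMulExp (tiedDown W i ω))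
        ≤ ENNReal.ofReal (2⁻¹ * (absMulExp (W i ω) + absMulExp (reflected W i ω))) := by
          rw [e]; exact ENNReal.ofReal_le_ofReal (this.trans (by linarith))
      _ = 2⁻¹ * (ENNReal.ofReal (absMulExp (W i ω)) +
            ENNReal.ofReal (absMulExp (reflected W i ω))) := by
          rw [ENNReal.ofReal_mul (by norm_num), ENNReal.ofReal_add (absMulExp_nonneg _)
            (absMulExp_nonneg _), ENNReal.ofReal_inv_of_pos (by norm_num)]
          simp
      _ ≤ _ := by
          gcongr
          · exact le_supAbsMulExp (W · ω) hi
          · exact le_supAbsMulExp (reflected W · ω) hi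
  calc _ ≤ ∫⁻ ω, 2⁻¹ * (supAbsMulExp I (W · ω) + supAbsMulExp I (reflected W · ω)) ∂P :=
        lintegral_mono hpt
    _ = 2⁻¹ * (2 * ∫⁻ ω, supAbsMulExp I (W · ω) ∂P) := by
        rw [lintegral_const_mul _ (by exact (hmeas _ hWm).add (hmeas _ hrm)),
          lintegral_add_left (hmeas _ hWm), lintegral_supAbsMulExp hW,
          lintegral_supAbsMulExp (isPreBrownianReal_reflected hW), two_mul]
    _ = _ := by rw [← mul_assoc, ENNReal.inv_mul_cancel (by simp) (by simp), one_mul]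

theorem abs_le_runningSup {ω : Ω} (hω : Continuous (W · ω)) {s : ℝ≥0} (hs : s ≤ 1) :
    |W s ω| ≤ runningSup W ω := by
  have hb : BddAbove (Set.range fun s : Set.Iic (1 : ℝ≥0) => |W s ω|) := by
    have : IsCompact (Set.Iic (1 : ℝ≥0)) := by
      rw [← Set.Icc_bot]; exact isCompact_Icc
    have := (this.image (hω.abs)).bddAbove
    rwa [Set.image_eq_range] at this
  exact le_ciSup hb ⟨s, hs⟩

theorem runningSup_nonneg (ω : Ω) : 0 ≤ runningSup W ω :=
  Real.iSup_nonneg fun _ => abs_nonneg _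

theorem absMulExp_runningSup (ω : Ω) :
    absMulExp (runningSup W ω) = runningSup W ω * Real.exp (runningSup W ω) := by
  rw [absMulExp, abs_of_nonneg (runningSup_nonneg ω)]

theorem lintegral_supAbsMulExp_le_runningSup (hW : IsBrownianReal W P) {I : Finset ℝ≥0}
    (hI : ∀ i ∈ I, i ≤ 1) :
    ∫⁻ ω, supAbsMulExp I (W · ω) ∂P ≤ ∫⁻ ω, ENNReal.ofReal (absMulExp (runningSup W ω)) ∂P := by
  refine lintegral_mono_ae ?_
  filter_upwards [hW.cont] with ω hω
  refine iSup_le fun i => ENNReal.ofReal_le_ofReal (absMulExp_mono ?_)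
  exact (abs_le_runningSup hω (hI i i.2)).trans (le_abs_self _)

/-- The tangent to `exp` at `p + c y` lies below the graph at `p + d y`; its slope is at most
`e^{|x|} e^{|y|}` because `p ≤ |x|` and `0 ≤ c ≤ 1`. -/
theorem exp_add_mul_le {p x y c d : ℝ} (hp : p ≤ |x|) (hc : 0 ≤ c) (hc1 : c ≤ 1) :
    Real.exp (p + c * y) ≤ Real.exp (p + d * y) + |c - d| * Real.exp |x| * absMulExp y := by
  have h1 : Real.exp (p + c * y) ≤ Real.exp |x| * Real.exp |y| := by
    rw [← Real.exp_add]
    apply Real.exp_le_exp.2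
    have : c * y ≤ |y| := (mul_le_mul_of_nonneg_left (le_abs_self y) hc).trans
      (mul_le_of_le_one_left (abs_nonneg y) hc1)
    linarith
  have h2 : (c - d) * y ≤ |c - d| * |y| := by rw [← abs_mul]; exact le_abs_self _
  have h3 := Real.add_one_le_exp ((p + d * y) - (p + c * y))
  rw [Real.exp_sub, le_div_iff₀ (Real.exp_pos _)] at h3
  have h4 : (c - d) * y * Real.exp (p + c * y) ≤
      |c - d| * |y| * (Real.exp |x| * Real.exp |y|) := by gcongr
  unfold absMulExp
  nlinarith

theorem mul_one_sub_grid_le (x : ℝ) {n k : ℕ} (hk : k ≤ n) : x * (1 - k / (n : ℝ)) ≤ |x| := by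
  have h : ((k / n : ℝ≥0) : ℝ) ≤ 1 := by exact_mod_cast grid_le_one hk
  push_cast at h
  have h0 : (0 : ℝ) ≤ k / n := by positivity
  calc x * (1 - k / (n : ℝ)) ≤ |x| * (1 - k / (n : ℝ)) := by
        gcongr
        exacts [le_abs_self x]
    _ ≤ |x| * 1 := by gcongr; linarith
    _ = |x| := mul_one _

/-- The grid `k / n`, `k ≤ n`. -/
noncomputable def unitGrid (n : ℕ) : Finset ℝ≥0 :=
  (Finset.range (n + 1)).image fun k : ℕ => (k / n : ℝ≥0)

theorem le_one_of_mem_unitGrid {n : ℕ} {i : ℝ≥0} (hi : i ∈ unitGrid n) : i ≤ 1 := by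
  obtain ⟨k, hk, rfl⟩ := Finset.mem_image.1 hi
  exact grid_le_one (by simpa [Nat.lt_succ_iff] using hk)

theorem mem_unitGrid {n k : ℕ} (hk : k ≤ n) : (k / n : ℝ≥0) ∈ unitGrid n :=
  Finset.mem_image.2 ⟨k, by simpa [Nat.lt_succ_iff] using hk, rfl⟩

/-- The rule optimal for `c` is merely admissible for `d`: both sampled bridges are built from one
path and one filtration, so their payoffs can be compared pointwise. -/
theorem gridValue_le_add (hW : IsBrownianReal W P) (hWm : ∀ t, Measurable (W t)) {c : ℝ≥0}
    (hc : c ≤ 1) (d : ℝ≥0) (n : ℕ) (x : ℝ) :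
    gridValue c n x ≤ gridValue d n x + ENNReal.ofReal (|(c : ℝ) - d| * Real.exp |x|) *
      ∫⁻ ω, ENNReal.ofReal (absMulExp (runningSup W ω)) ∂P := by
  have hexp : Measurable fun y => ENNReal.ofReal (Real.exp y) := by fun_prop
  have hch := isGaussianChain_sampledBridge hW.toIsPreBrownianReal hWm c n x
  have hch' := isGaussianChain_sampledBridge hW.toIsPreBrownianReal hWm d n x
  obtain ⟨σ, hσ, hσn, hle⟩ := hch.exists_stopping hexp
  rw [lintegral_snell_sampledBridge hW.toIsPreBrownianReal] at hle
  have hub := hch'.lintegral_le_snell hexp hσ hσn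
  rw [lintegral_snell_sampledBridge hW.toIsPreBrownianReal] at hub
  have hbd := (lintegral_supAbsMulExp_tiedDown_le hW.toIsPreBrownianReal hWm
    (I := unitGrid n) fun _ => le_one_of_mem_unitGrid).trans
    (lintegral_supAbsMulExp_le_runningSup hW fun _ => le_one_of_mem_unitGrid)
  have hmeas : Measurable fun ω => supAbsMulExp (unitGrid n) (tiedDown W · ω) := by
    unfold supAbsMulExp
    exact Measurable.iSup fun i =>
      (measurable_absMulExp.comp (measurable_tiedDown hWm _)).ennreal_ofReal
  refine hle.trans (le_trans ?_ (add_le_add hub (mul_le_mul_right hbd _)))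
  rw [← lintegral_const_mul _ hmeas, ← lintegral_add_right _ (hmeas.const_mul _)]
  refine lintegral_mono fun ω => ?_
  refine le_trans ?_ (add_le_add_right (mul_le_mul_right
    (le_supAbsMulExp (tiedDown W · ω) (mem_unitGrid (hσn ω))) _) _)
  rw [← ENNReal.ofReal_mul (by positivity), ← ENNReal.ofReal_add (by positivity)
    (mul_nonneg (by positivity) (absMulExp_nonneg _))]
  exact ENNReal.ofReal_le_ofReal
    (exp_add_mul_le (mul_one_sub_grid_le x (hσn ω)) c.2 (by exact_mod_cast hc))

theorem gridValue_zero_le (hW : IsPreBrownianReal W P) (hWm : ∀ t, Measurable (W t)) (n : ℕ)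
    (x : ℝ) : gridValue 0 n x ≤ ENNReal.ofReal (Real.exp |x|) := by
  have := hW.isGaussianProcess.isProbabilityMeasure
  obtain ⟨σ, hσ, hσn, hle⟩ := (isGaussianChain_sampledBridge hW hWm 0 n x).exists_stopping
    (g := fun y => ENNReal.ofReal (Real.exp y)) (by fun_prop)
  rw [lintegral_snell_sampledBridge hW] at hle
  calc _ ≤ _ := hle
    _ ≤ ∫⁻ _, ENNReal.ofReal (Real.exp |x|) ∂P := lintegral_mono fun ω =>
        ENNReal.ofReal_le_ofReal (Real.exp_le_exp.2 (by
          simpa [sampledBridge] using mul_one_sub_grid_le x (hσn ω)))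
    _ = _ := by simp

end MaximalBound

/-! ### Integrability of `S_1 exp (S_1)` and positivity of `c_2`. -/

section RunningSup

variable {Ω : Type*} {mΩ : MeasurableSpace Ω} {P : Measure Ω} {W : ℝ≥0 → Ω → ℝ}

theorem indepFun_increment (hW : IsPreBrownianReal W P) {r s : ℝ≥0} (hrs : r ≤ s) {ι : Type*}
    {u : ι → ℝ≥0} (hu : ∀ i, u i ≤ r) :
    IndepFun (fun ω i => W (u i) ω) (fun ω => W s ω - W r ω) P := by
  have h := (hW.indepFun_shift r).symm
  have h1 : Measurable fun (f : Set.Iic r → ℝ) (i : ι) => f ⟨u i, hu i⟩ :=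
    measurable_pi_lambda _ fun i => measurable_pi_apply _
  have h2 : Measurable fun f : ℝ≥0 → ℝ => f (s - r) := measurable_pi_apply _
  have := h.comp h1 h2
  simpa [Function.comp_def, add_tsub_cancel_of_le hrs] using this

theorem hasLaw_increment (hW : IsPreBrownianReal W P) {r s : ℝ≥0} (hrs : r ≤ s) :
    HasLaw (fun ω => W s ω - W r ω) (gaussianReal 0 (s - r)) P := by
  have h := (hW.shift r).hasLaw_eval (s - r)
  simpa [add_tsub_cancel_of_le hrs] using h

/-- The filtration generated by the motion on the grid `k / n`. -/
noncomputable def gridFiltration (W : ℝ≥0 → Ω → ℝ) (hWm : ∀ t, Measurable (W t)) (n : ℕ) :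
    Filtration ℕ mΩ :=
  Filtration.natural (fun k : ℕ => W (k / n)) fun _ => (hWm _).stronglyMeasurable

theorem isGaussianChain_motion (hW : IsPreBrownianReal W P) (hWm : ∀ t, Measurable (W t))
    (n : ℕ) :
    IsGaussianChain P (gridFiltration W hWm n) (fun _ => 1) (fun _ => 1 / n) n
      (fun k => W (k / n)) := by
  have := hW.isGaussianProcess.isProbabilityMeasure
  have hm : ∀ k : ℕ, Measurable[gridFiltration W hWm n k] (W (k / n)) := fun k =>
    ((Filtration.stronglyAdapted_natural (u := fun k : ℕ => W (k / n))
      fun _ => (hWm _).stronglyMeasurable) k).measurable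
  refine ⟨fun k _ => hm k, fun k hk A hA h hh => ?_⟩
  have h1 := grid_mono n k.le_succ
  refine lintegral_gaussStep_of_indep ((gridFiltration W hWm n).le k) (hm k)
    (N := fun ω => W ((k + 1 : ℕ) / n) ω - W (k / n) ω) ?_ ?_ (ae_of_all _ fun ω => ?_)
    hA hh
  · convert hasLaw_increment hW h1 using 2
    rw [← tsub_div]
    simp
  · intro Z hZ
    refine indepFun_of_measurable ?_ hZ
    rw [gridFiltration, Filtration.natural_eq_comap]
    exact (indepFun_increment hW h1 (u := fun j : Set.Iic k => (j / n : ℝ≥0))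
      fun j => grid_mono n j.2)
  · ring

/-- The submartingale reward `exp (4 y) + exp (-4 y)`. -/
noncomputable def twoSidedExp (y : ℝ) : ℝ≥0∞ :=
  ENNReal.ofReal (Real.exp (4 * y)) + ENNReal.ofReal (Real.exp (-4 * y))

theorem measurable_twoSidedExp : Measurable twoSidedExp := by unfold twoSidedExp; fun_prop

theorem lintegral_exp_mul_gaussian (b : ℝ) (q : ℝ≥0) :
    ∫⁻ y, ENNReal.ofReal (Real.exp (b * y)) ∂gaussianReal 0 q =
      ENNReal.ofReal (Real.exp (b ^ 2 * q / 2)) := by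
  rw [← ofReal_integral_eq_lintegral_ofReal (integrable_exp_mul_gaussianReal b)
    (ae_of_all _ fun _ => (Real.exp_pos _).le)]
  have := congrFun (mgf_fun_id_gaussianReal (μ := 0) (v := q)) b
  rw [mgf] at this
  rw [this]; ring_nf

theorem gaussStep_twoSidedExp (q : ℝ≥0) (x : ℝ) :
    gaussStep 1 q twoSidedExp x = ENNReal.ofReal (Real.exp (8 * q)) * twoSidedExp x := by
  have e : ∀ b x y : ℝ, ENNReal.ofReal (Real.exp (b * (1 * x + y))) =
      ENNReal.ofReal (Real.exp (b * x)) * ENNReal.ofReal (Real.exp (b * y)) := fun b x y => by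
    rw [← ENNReal.ofReal_mul (Real.exp_pos _).le, ← Real.exp_add]; ring_nf
  unfold gaussStep twoSidedExp
  rw [lintegral_add_left (by fun_prop)]
  simp_rw [e]
  rw [lintegral_const_mul _ (by fun_prop), lintegral_const_mul _ (by fun_prop),
    lintegral_exp_mul_gaussian, lintegral_exp_mul_gaussian,
    show (4 : ℝ) ^ 2 * q / 2 = 8 * q by ring, show (-4 : ℝ) ^ 2 * q / 2 = 8 * q by ring]
  ring

/-- `twoSidedExp` is an eigenfunction of each step with eigenvalue `e^{8q} ≥ 1`, so the bound grows
by that factor per step. -/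
theorem snell_twoSidedExp_le (q : ℝ≥0) (k m : ℕ) (x : ℝ) :
    snell twoSidedExp (fun _ => 1) (fun _ => q) k m x ≤
      ENNReal.ofReal (Real.exp (8 * q * m)) * twoSidedExp x := by
  induction m generalizing k x with
  | zero => simp [snell]
  | succ m ih =>
    refine max_le ?_ ?_
    · refine le_mul_of_one_le_left (by simp) ?_
      rw [← ENNReal.ofReal_one]
      exact ENNReal.ofReal_le_ofReal (Real.one_le_exp (by positivity))
    · refine (gaussStep_mono 1 q (ih (k + 1)) x).trans (le_of_eq ?_)
      have : gaussStep 1 q (fun x => ENNReal.ofReal (Real.exp (8 * q * m)) * twoSidedExp x) x =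
          ENNReal.ofReal (Real.exp (8 * q * m)) * gaussStep 1 q twoSidedExp x := by
        unfold gaussStep
        exact lintegral_const_mul _ (measurable_twoSidedExp.comp (by fun_prop))
      rw [this, gaussStep_twoSidedExp, ← mul_assoc, ← ENNReal.ofReal_mul (Real.exp_pos _).le,
        ← Real.exp_add]
      push_cast
      ring_nf

theorem twoSidedExp_maximal_le (hW : IsPreBrownianReal W P) (hWm : ∀ t, Measurable (W t))
    (n : ℕ) (L : ℝ≥0∞) :
    L * P {ω | ∃ k ≤ n, L ≤ twoSidedExp (W (k / n) ω)} ≤ ENNReal.ofReal (Real.exp 8) * 2 := by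
  have := hW.isGaussianProcess.isProbabilityMeasure
  refine ((isGaussianChain_motion hW hWm n).maximal_le measurable_twoSidedExp L).trans ?_
  calc _ ≤ ∫⁻ ω, ENNReal.ofReal (Real.exp 8) * 2 ∂P := by
        refine lintegral_mono_ae ?_
        filter_upwards [hW.eval_zero_ae_eq_zero] with ω hω
        refine (snell_twoSidedExp_le _ _ _ _).trans ?_
        simp only [Nat.cast_zero, zero_div, hω]
        gcongr
        · push_cast
          -- The `n` steps have total variance `1`, whence `e^8`. For `n = 0` the exponent is `0`,
          -- since there is no step.
          rcases Nat.eq_zero_or_pos n with rfl | hn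
          · simp
          · have : (n : ℝ) ≠ 0 := by positivity
            exact le_of_eq (by field_simp)
        · simp [twoSidedExp, one_add_one_eq_two]
    _ = _ := by simp

/-- Take `2^j ≤ e^{2|w|} < 2^{j+1}`. Squaring the lower bound gives the level `4^j`, while `|w|
e^{|w|} ≤ e^{2|w|}` gives the upper bound. -/
theorem ofReal_absMulExp_le (w : ℝ) : ∃ j : ℕ, (4 : ℝ≥0∞) ^ j ≤ twoSidedExp w ∧
    ENNReal.ofReal (absMulExp w) ≤ 2 ^ (j + 1) := by
  obtain ⟨j, h1, h2⟩ := exists_nat_pow_near (x := Real.exp (2 * |w|)) (y := 2)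
    (Real.one_le_exp (by positivity)) one_lt_two
  refine ⟨j, ?_, ?_⟩
  · have h3 : (4 : ℝ) ^ j ≤ Real.exp (4 * |w|) := by
      have : Real.exp (4 * |w|) = Real.exp (2 * |w|) ^ 2 := by
        rw [← Real.exp_nat_mul]; push_cast; ring_nf
      rw [this, show (4 : ℝ) = 2 ^ 2 by norm_num, pow_right_comm]
      gcongr
    have h4 : (4 : ℝ≥0∞) ^ j ≤ ENNReal.ofReal (Real.exp (4 * |w|)) := by
      rw [← ENNReal.ofReal_ofNat, ← ENNReal.ofReal_pow (by norm_num)]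
      exact ENNReal.ofReal_le_ofReal h3
    refine h4.trans ?_
    rcases abs_cases w with ⟨h, -⟩ | ⟨h, -⟩ <;> rw [h, twoSidedExp]
    · exact le_self_add
    · rw [mul_neg, ← neg_mul]; exact le_add_self
  · rw [← ENNReal.ofReal_ofNat, ← ENNReal.ofReal_pow (by norm_num)]
    refine ENNReal.ofReal_le_ofReal (le_trans ?_ h2.le)
    have : Real.exp (2 * |w|) = Real.exp |w| * Real.exp |w| := by rw [← Real.exp_add]; ring_nf
    rw [this, absMulExp]
    gcongr
    linarith [Real.add_one_le_exp |w|]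

/-- Summing over dyadic levels: the weight `2^{j+1}` meets a probability of order `4^{-j}`, leaving
a geometric series whose bound does not depend on the grid. -/
theorem lintegral_supAbsMulExp_unitGrid_le (hW : IsPreBrownianReal W P)
    (hWm : ∀ t, Measurable (W t)) (n : ℕ) :
    ∫⁻ ω, supAbsMulExp (unitGrid n) (W · ω) ∂P ≤ ENNReal.ofReal (Real.exp 8) * 8 := by
  set A : ℕ → Set Ω := fun j => {ω | ∃ k ≤ n, (4 : ℝ≥0∞) ^ j ≤ twoSidedExp (W (k / n) ω)}
    with hA
  have hAm : ∀ j, MeasurableSet (A j) := fun j => by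
    have : A j = ⋃ k ∈ Finset.range (n + 1),
        {ω | (4 : ℝ≥0∞) ^ j ≤ twoSidedExp (W (k / n) ω)} := by
      ext ω; simp [hA]
    rw [this]
    exact Finset.measurableSet_biUnion _ fun k _ =>
      measurableSet_le measurable_const (measurable_twoSidedExp.comp (hWm _))
  have hpt : ∀ ω, supAbsMulExp (unitGrid n) (W · ω) ≤
      ∑' j, (A j).indicator (fun _ => (2 : ℝ≥0∞) ^ (j + 1)) ω := fun ω => by
    refine iSup_le fun ⟨i, hi⟩ => ?_
    obtain ⟨k, hk, rfl⟩ := Finset.mem_image.1 hi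
    obtain ⟨j, h1, h2⟩ := ofReal_absMulExp_le (W (k / n) ω)
    refine h2.trans (le_trans (le_of_eq ?_) (ENNReal.le_tsum j))
    rw [Set.indicator_of_mem]
    exact ⟨k, by simpa [Nat.lt_succ_iff] using hk, h1⟩
  have hterm : ∀ j : ℕ, ∫⁻ ω, (A j).indicator (fun _ => (2 : ℝ≥0∞) ^ (j + 1)) ω ∂P ≤
      (ENNReal.ofReal (Real.exp 8) * 4) * 2⁻¹ ^ j := fun j => by
    rw [lintegral_indicator_const (hAm j)]
    have h := twoSidedExp_maximal_le hW hWm n ((4 : ℝ≥0∞) ^ j)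
    have h22 : (2⁻¹ : ℝ≥0∞) ^ j * 2 ^ j = 1 := by
      rw [← mul_pow, ENNReal.inv_mul_cancel (by simp) (by simp), one_pow]
    calc (2 : ℝ≥0∞) ^ (j + 1) * P (A j)
        = (2⁻¹ ^ j * 2 ^ j) * ((2 : ℝ≥0∞) ^ (j + 1) * P (A j)) := by rw [h22, one_mul]
      _ = 2⁻¹ ^ j * 2 * ((4 : ℝ≥0∞) ^ j * P (A j)) := by
          rw [show (4 : ℝ≥0∞) = 2 * 2 by norm_num, mul_pow]; ring
      _ ≤ 2⁻¹ ^ j * 2 * (ENNReal.ofReal (Real.exp 8) * 2) := by gcongr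
      _ = _ := by rw [show (4 : ℝ≥0∞) = 2 * 2 by norm_num]; ring
  calc _ ≤ ∫⁻ ω, ∑' j, (A j).indicator (fun _ => (2 : ℝ≥0∞) ^ (j + 1)) ω ∂P := lintegral_mono hpt
    _ = ∑' j, ∫⁻ ω, (A j).indicator (fun _ => (2 : ℝ≥0∞) ^ (j + 1)) ω ∂P :=
        lintegral_tsum fun j => (measurable_const.indicator (hAm j)).aemeasurable
    _ ≤ ∑' j : ℕ, (ENNReal.ofReal (Real.exp 8) * 4) * 2⁻¹ ^ j := ENNReal.tsum_le_tsum hterm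
    _ = _ := by
        rw [ENNReal.tsum_mul_left, ENNReal.tsum_geometric, ENNReal.one_sub_inv_two, inv_inv,
          mul_assoc]
        norm_num

theorem tendsto_floor_grid (s : ℝ≥0) :
    Tendsto (fun n : ℕ => ((⌊s * n⌋₊ : ℕ) / n : ℝ≥0)) atTop (𝓝 s) := by
  have := (tendsto_nat_floor_mul_div_atTop (R := ℝ) s.2).comp tendsto_natCast_atTop_atTop
  rw [← NNReal.tendsto_coe]
  refine this.congr fun n => ?_
  simp only [Function.comp]
  push_cast
  congr 2

theorem floor_grid_le {s : ℝ≥0} (hs : s ≤ 1) (n : ℕ) : ⌊s * n⌋₊ ≤ n :=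
  Nat.floor_le_of_le (mul_le_of_le_one_left (by positivity) hs)

theorem exists_runningSup_eq {ω : Ω} (hω : Continuous (W · ω)) :
    ∃ s ≤ 1, runningSup W ω = |W s ω| := by
  have hc : IsCompact (Set.Iic (1 : ℝ≥0)) := by
    rw [← Set.Icc_bot]; exact isCompact_Icc
  obtain ⟨s, hs, hmax⟩ := hc.exists_isMaxOn ⟨0, by simp⟩ hω.abs.continuousOn
  refine ⟨s, hs, le_antisymm ?_ (abs_le_runningSup hω hs)⟩
  have : Nonempty (Set.Iic (1 : ℝ≥0)) := ⟨⟨s, hs⟩⟩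
  exact ciSup_le fun u => hmax u.2

/-- By continuity the supremum is attained at some `s`, and the grid points below `s` converge to
it; Fatou's lemma then carries over the uniform grid bound. -/
theorem lintegral_runningSup_lt_top (hW : IsBrownianReal W P) (hWm : ∀ t, Measurable (W t)) :
    ∫⁻ ω, ENNReal.ofReal (absMulExp (runningSup W ω)) ∂P < ∞ := by
  have hmeas : ∀ n, Measurable fun ω => supAbsMulExp (unitGrid n) (W · ω) := fun n =>
    Measurable.iSup fun i => (measurable_absMulExp.comp (hWm _)).ennreal_ofReal
  have hle : ∀ᵐ ω ∂P, ENNReal.ofReal (absMulExp (runningSup W ω)) ≤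
      liminf (fun n => supAbsMulExp (unitGrid n) (W · ω)) atTop := by
    filter_upwards [hW.cont] with ω hω
    obtain ⟨s, hs, hsup⟩ := exists_runningSup_eq hω
    have hlim : Tendsto (fun n : ℕ => ENNReal.ofReal (absMulExp (W ((⌊s * n⌋₊ : ℕ) / n) ω))) atTop
        (𝓝 (ENNReal.ofReal (absMulExp (W s ω)))) := by
      have hcont : Continuous fun u => ENNReal.ofReal (absMulExp (W u ω)) := by
        unfold absMulExp
        exact ENNReal.continuous_ofReal.comp (by fun_prop)
      exact (hcont.tendsto s).comp (tendsto_floor_grid s)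
    have e : absMulExp (runningSup W ω) = absMulExp (W s ω) := by
      rw [hsup, absMulExp, absMulExp, abs_abs]
    rw [e, ← hlim.liminf_eq]
    exact liminf_le_liminf (Eventually.of_forall fun n =>
      le_supAbsMulExp (W · ω) (mem_unitGrid (floor_grid_le hs n)))
  calc _ ≤ ∫⁻ ω, liminf (fun n => supAbsMulExp (unitGrid n) (W · ω)) atTop ∂P :=
        lintegral_mono_ae hle
    _ ≤ liminf (fun n => ∫⁻ ω, supAbsMulExp (unitGrid n) (W · ω) ∂P) atTop :=
        lintegral_liminf_le hmeas
    _ ≤ ENNReal.ofReal (Real.exp 8) * 8 := by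
        refine liminf_le_of_le (by isBoundedDefault) fun b hb => ?_
        obtain ⟨n, hn⟩ := hb.exists
        exact hn.trans (lintegral_supAbsMulExp_unitGrid_le hW.toIsPreBrownianReal hWm n)
    _ < ∞ := ENNReal.mul_lt_top ENNReal.ofReal_lt_top (by simp)

theorem aemeasurable_runningSup (hW : IsBrownianReal W P) (hWm : ∀ t, Measurable (W t)) :
    AEMeasurable (runningSup W) P := by
  set f : ℕ → Ω → ℝ := fun n ω =>
    (Finset.range (n + 1)).sup' Finset.nonempty_range_add_one fun k : ℕ => |W (k / n) ω| with hf
  refine aemeasurable_of_tendsto_metrizable_ae atTop (f := f) (fun n => ?_) ?_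
  · exact (Finset.measurable_range_sup'' fun k _ => (hWm _).abs).aemeasurable
  · filter_upwards [hW.cont] with ω hω
    obtain ⟨s, hs, hsup⟩ := exists_runningSup_eq hω
    have hlim : Tendsto (fun n : ℕ => |W ((⌊s * n⌋₊ : ℕ) / n) ω|) atTop (𝓝 (runningSup W ω)) := by
      rw [hsup]
      exact (hω.abs.tendsto s).comp (tendsto_floor_grid s)
    refine tendsto_of_tendsto_of_tendsto_of_le_of_le hlim tendsto_const_nhds (fun n => ?_)
      fun n => ?_
    · exact Finset.le_sup' (fun k : ℕ => |W (k / n) ω|)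
        (Finset.mem_range.2 (Nat.lt_succ_of_le (floor_grid_le hs n)))
    · exact Finset.sup'_le _ _ fun k hk => abs_le_runningSup hω
        (grid_le_one (by simpa [Nat.lt_succ_iff] using hk))

theorem integrable_runningSup (hW : IsBrownianReal W P) (hWm : ∀ t, Measurable (W t)) :
    Integrable (fun ω => absMulExp (runningSup W ω)) P := by
  refine ⟨(measurable_absMulExp.comp_aemeasurable
    (aemeasurable_runningSup hW hWm)).aestronglyMeasurable, ?_⟩
  rw [hasFiniteIntegral_iff_ofReal (ae_of_all _ fun _ => absMulExp_nonneg _)]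
  exact lintegral_runningSup_lt_top hW hWm

theorem c2_eq : c2 P W = ∫ ω, absMulExp (runningSup W ω) ∂P := by
  simp only [c2, absMulExp_runningSup]

theorem ofReal_c2 (hW : IsBrownianReal W P) (hWm : ∀ t, Measurable (W t)) :
    ENNReal.ofReal (c2 P W) = ∫⁻ ω, ENNReal.ofReal (absMulExp (runningSup W ω)) ∂P := by
  rw [c2_eq, ofReal_integral_eq_lintegral_ofReal (integrable_runningSup hW hWm)
    (ae_of_all _ fun _ => absMulExp_nonneg _)]

/-- `W_1` is almost surely nonzero, so `S_1 > 0` almost surely. -/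
theorem c2_pos (hW : IsBrownianReal W P) (hWm : ∀ t, Measurable (W t)) : 0 < c2 P W := by
  have := hW.isGaussianProcess.isProbabilityMeasure
  have hnn : 0 ≤ᵐ[P] fun ω => absMulExp (runningSup W ω) := ae_of_all _ fun _ => absMulExp_nonneg _
  rw [c2_eq]
  refine lt_of_le_of_ne (integral_nonneg_of_ae hnn) fun h => ?_
  have h0 := (integral_eq_zero_iff_of_nonneg_ae hnn (integrable_runningSup hW hWm)).1 h.symm
  have h1 : ∀ᵐ ω ∂P, W 1 ω ≠ 0 := by
    have hlaw := hW.hasLaw_eval 1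
    have : NullSingletonClass (gaussianReal 0 1) := nullSingletonClass_gaussianReal one_ne_zero
    have h2 : ∀ᵐ y ∂gaussianReal 0 1, y ≠ 0 := by
      simp [ae_iff]
    rw [← hlaw.map_eq] at h2
    exact ae_of_ae_map hlaw.aemeasurable h2
  have h2 : ∀ᵐ ω ∂P, False := by
    filter_upwards [h0, h1, hW.cont] with ω hω hω1 hωc
    have h3 : 0 < runningSup W ω := (abs_pos.2 hω1).trans_le (abs_le_runningSup hωc le_rfl)
    have h4 : 0 < absMulExp (runningSup W ω) := by unfold absMulExp; positivity
    exact h4.ne' hω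
  exact h2.exists.elim fun _ => id

end RunningSup

/-! ### Riemann-Stieltjes sums and summation by parts. -/

section RiemannSums

theorem tendsto_riemannSum {a b : ℝ} (hab : a ≤ b) {g h : ℝ → ℝ}
    (hg : ContinuousOn g (Set.Icc a b)) (hh : ContinuousOn h (Set.Icc a b))
    {u c : ℕ → ℕ → ℝ} (hu : ∀ n j : ℕ, u n j = a + (b - a) * (j / n))
    (hc : ∀ n, ∀ j < n, c n j ∈ Set.Icc (u n j) (u n (j + 1))) :
    Tendsto (fun n : ℕ => ∑ j ∈ Finset.range n, g (c n j) * ∫ v in (u n j)..(u n (j + 1)), h v)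
      atTop (𝓝 (∫ v in a..b, g v * h v)) := by
  have hmono : ∀ n j, u n j ≤ u n (j + 1) := fun n j => by
    rw [hu, hu]; gcongr
    exact Nat.le_succ j
  have hmem : ∀ n, ∀ j ≤ n, u n j ∈ Set.Icc a b := fun n j hj => by
    rw [hu]
    have h1 : (j / n : ℝ) ≤ 1 := div_le_one_of_le₀ (by exact_mod_cast hj) (by positivity)
    have h0 : (0 : ℝ) ≤ j / n := by positivity
    constructor <;> nlinarith
  have hsub : ∀ n, ∀ j < n, Set.Icc (u n j) (u n (j + 1)) ⊆ Set.Icc a b := fun n j hj =>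
    Set.Icc_subset_Icc (hmem n j hj.le).1 (hmem n (j + 1) hj).2
  have hint : ∀ {k : ℝ → ℝ}, ContinuousOn k (Set.Icc a b) → ∀ n, ∀ j < n,
      IntervalIntegrable k volume (u n j) (u n (j + 1)) := fun hk n j hj =>
    (hk.mono (hsub n j hj)).intervalIntegrable_of_Icc (hmono n j)
  have hends : ∀ n, 0 < n → u n 0 = a ∧ u n n = b := fun n hn => by
    have : (n : ℝ) ≠ 0 := by positivity
    rw [hu, hu, div_self this]; simp
  have huc := isCompact_Icc.uniformContinuousOn_of_continuous hg
  rw [Metric.uniformContinuousOn_iff_le] at huc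
  rw [Metric.tendsto_atTop']
  intro ε hε
  set M := ∫ v in a..b, |h v| with hM
  have hM0 : 0 ≤ M := intervalIntegral.integral_nonneg hab fun _ _ => abs_nonneg _
  -- `M + 1` instead of `M`, since `M` may vanish.
  obtain ⟨δ, hδ, hδε⟩ := huc (ε / (2 * (M + 1))) (by positivity)
  obtain ⟨N, hN⟩ := exists_nat_gt ((b - a) / δ)
  refine ⟨N, fun n hn => ?_⟩
  have hn0 : 0 < n := (Nat.zero_le _).trans_lt hn
  have hmesh : ∀ j, u n (j + 1) - u n j ≤ δ := fun j => by
    rw [hu, hu]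
    have h1 : (b - a) / δ < n := hN.trans (by exact_mod_cast hn)
    rw [div_lt_iff₀ hδ] at h1
    have hn' : (0 : ℝ) < n := by exact_mod_cast hn0
    have : a + (b - a) * ((j + 1 : ℕ) / n) - (a + (b - a) * (j / n)) = (b - a) / n := by
      push_cast; field_simp; ring
    rw [this, div_le_iff₀ hn']
    linarith
  have hgh : ContinuousOn (fun v => g v * h v) (Set.Icc a b) := hg.mul hh
  have e1 : ∫ v in a..b, g v * h v =
      ∑ j ∈ Finset.range n, ∫ v in (u n j)..(u n (j + 1)), g v * h v := by
    rw [intervalIntegral.sum_integral_adjacent_intervals fun j hj => hint hgh n j hj,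
      (hends n hn0).1, (hends n hn0).2]
  have e2 : M = ∑ j ∈ Finset.range n, ∫ v in (u n j)..(u n (j + 1)), |h v| := by
    rw [intervalIntegral.sum_integral_adjacent_intervals fun j hj => hint hh.abs n j hj,
      (hends n hn0).1, (hends n hn0).2]
  rw [Real.dist_eq, e1, ← Finset.sum_sub_distrib]
  calc |∑ j ∈ Finset.range n, (g (c n j) * (∫ v in (u n j)..(u n (j + 1)), h v) -
          ∫ v in (u n j)..(u n (j + 1)), g v * h v)|
      ≤ ∑ j ∈ Finset.range n, |g (c n j) * (∫ v in (u n j)..(u n (j + 1)), h v) -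
          ∫ v in (u n j)..(u n (j + 1)), g v * h v| := Finset.abs_sum_le_sum_abs _ _
    _ ≤ ∑ j ∈ Finset.range n, ε / (2 * (M + 1)) * ∫ v in (u n j)..(u n (j + 1)), |h v| := by
        refine Finset.sum_le_sum fun j hj => ?_
        have hj' := Finset.mem_range.1 hj
        rw [← intervalIntegral.integral_const_mul, ← intervalIntegral.integral_const_mul,
          ← intervalIntegral.integral_sub ((hint hh n j hj').const_mul _) (hint hgh n j hj'),
          ← Real.norm_eq_abs]
        refine intervalIntegral.norm_integral_le_of_norm_le (hmono n j)
          (ae_of_all _ fun v hv => ?_) ((hint hh.abs n j hj').const_mul _)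
        rw [← sub_mul, norm_mul, Real.norm_eq_abs, Real.norm_eq_abs]
        have hv' := Set.Ioc_subset_Icc_self hv
        gcongr
        refine hδε _ (hsub n j hj' (hc n j hj')) _ (hsub n j hj' hv') ?_
        exact (Real.dist_le_of_mem_Icc (hc n j hj') hv').trans (hmesh j)
    _ = ε / (2 * (M + 1)) * M := by rw [← Finset.mul_sum, ← e2]
    _ < ε := by
        rw [div_mul_eq_mul_div, div_lt_iff₀ (by positivity)]
        nlinarith

theorem sum_mul_sub_eq (f w : ℕ → ℝ) (n : ℕ) :
    ∑ j ∈ Finset.range n, f j * (w (j + 1) - w j) =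
      f n * w n - f 0 * w 0 - ∑ j ∈ Finset.range n, w (j + 1) * (f (j + 1) - f j) := by
  induction n with
  | zero => simp
  | succ n ih => rw [Finset.sum_range_succ, Finset.sum_range_succ, ih]; ring

theorem continuousOn_inv_one_sub_sq {a b : ℝ} (hb : b < 1) :
    ContinuousOn (fun v : ℝ => ((1 - v) ^ 2)⁻¹) (Set.Icc a b) := by
  refine ContinuousOn.inv₀ (by fun_prop) fun v hv => ?_
  have : 0 < 1 - v := by linarith [hv.2]
  positivity

theorem integral_inv_one_sub_sq {a b : ℝ} (hab : a ≤ b) (hb : b < 1) :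
    ∫ v in a..b, ((1 - v) ^ 2)⁻¹ = (1 - b)⁻¹ - (1 - a)⁻¹ := by
  refine intervalIntegral.integral_eq_sub_of_hasDerivAt (f := fun v => (1 - v)⁻¹) (fun v hv => ?_)
    ((continuousOn_inv_one_sub_sq hb).intervalIntegrable_of_Icc hab)
  rw [Set.uIcc_of_le hab] at hv
  have : 1 - v ≠ 0 := by linarith [hv.2]
  have h := ((hasDerivAt_id v).const_sub 1).fun_inv this
  simpa [one_div] using h

end RiemannSums

/-! ### The law of the pathwise Wiener integral. -/

section Wiener

variable {Ω : Type*} {mΩ : MeasurableSpace Ω} {P : Measure Ω} {W : ℝ≥0 → Ω → ℝ}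

/-- The uniform partition of `[t, s]`. -/
noncomputable def part (t s : ℝ≥0) (n j : ℕ) : ℝ≥0 := t + (s - t) * (j / n)

theorem part_mono (t s : ℝ≥0) (n : ℕ) : Monotone (part t s n) := fun i j hij => by
  unfold part
  have := grid_mono n hij
  gcongr

theorem part_le {t s : ℝ≥0} (hts : t ≤ s) {n j : ℕ} (hj : j ≤ n) : part t s n j ≤ s := by
  unfold part
  calc t + (s - t) * (j / n) ≤ t + (s - t) * 1 := by gcongr; exact grid_le_one hj
    _ = s := by rw [mul_one, add_tsub_cancel_of_le hts]

theorem le_part (t s : ℝ≥0) (n j : ℕ) : t ≤ part t s n j := le_self_add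

theorem coe_part {t s : ℝ≥0} (hts : t ≤ s) (n j : ℕ) :
    (part t s n j : ℝ) = t + (s - t) * (j / n) := by
  simp [part, NNReal.coe_sub hts]

theorem part_self {t s : ℝ≥0} (hts : t ≤ s) {n : ℕ} (hn : 0 < n) : part t s n n = s := by
  have : (n : ℝ≥0) ≠ 0 := by positivity
  rw [part, div_self this, mul_one, add_tsub_cancel_of_le hts]

/-- Riemann-Stieltjes sums of the Wiener integral `∫_t^s dW_u / (1 - u)`. -/
noncomputable def wienerSum (W : ℝ≥0 → Ω → ℝ) (t s : ℝ≥0) (n : ℕ) (ω : Ω) : ℝ :=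
  ∑ j ∈ Finset.range n, (1 - (part t s n j : ℝ))⁻¹ *
    (W (part t s n (j + 1)) ω - W (part t s n j) ω)

theorem tendsto_wienerSum {ω : Ω} (hω : Continuous (W · ω)) {t s : ℝ≥0} (hts : t ≤ s)
    (hs : s < 1) :
    Tendsto (fun n => wienerSum W t s n ω) atTop (𝓝 (wienerIntegral W t s ω)) := by
  have hs1 : (s : ℝ) < 1 := by exact_mod_cast hs
  have hts' : (t : ℝ) ≤ s := hts
  have hlt : ∀ n, ∀ j ≤ n, (part t s n j : ℝ) < 1 := fun n j hj =>
    (NNReal.coe_le_coe.2 (part_le hts hj)).trans_lt hs1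
  -- Right endpoints as tags, to match the factor `w (j + 1)` left by summation by parts.
  have key := tendsto_riemannSum (g := fun v => W v.toNNReal ω) (h := fun v => ((1 - v) ^ 2)⁻¹)
    (u := fun n j => part t s n j) (c := fun n j => part t s n (j + 1)) hts'
    (hω.comp continuous_real_toNNReal).continuousOn
    (continuousOn_inv_one_sub_sq hs1) (fun n j => coe_part hts n j)
    (fun n j _ => ⟨NNReal.coe_le_coe.2 (part_mono t s n j.le_succ), le_rfl⟩)
  have h2 := key.const_sub (W s ω / (1 - s) - W t ω / (1 - t))
  refine (h2.congr' ?_)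
  filter_upwards [eventually_gt_atTop 0] with n hn
  rw [wienerSum, sum_mul_sub_eq (fun j => (1 - (part t s n j : ℝ))⁻¹) (fun j => W (part t s n j) ω)]
  congr 1
  · rw [part_self hts hn]
    simp [part, div_eq_inv_mul]
  · refine Finset.sum_congr rfl fun j hj => ?_
    rw [integral_inv_one_sub_sq (NNReal.coe_le_coe.2 (part_mono t s n j.le_succ))
      (hlt n (j + 1) (Finset.mem_range.1 hj)), Real.toNNReal_coe]

theorem hasLaw_sum_increments (hW : IsPreBrownianReal W P) {u : ℕ → ℝ≥0} (hu : Monotone u)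
    (c : ℕ → ℝ) (n : ℕ) :
    HasLaw (fun ω => ∑ j ∈ Finset.range n, c j * (W (u (j + 1)) ω - W (u j) ω))
      (gaussianReal 0 (∑ j ∈ Finset.range n, NNReal.mk (c j ^ 2) (sq_nonneg _) * (u (j + 1) - u j))) P := by
  have := hW.isGaussianProcess.isProbabilityMeasure
  induction n with
  | zero =>
    simp only [Finset.range_zero, Finset.sum_empty, gaussianReal_zero_var]
    exact ⟨aemeasurable_const, by simp⟩
  | succ n ih =>
    simp only [Finset.sum_range_succ]
    have h1 := gaussianReal_const_mul (hasLaw_increment hW (hu n.le_succ)) (c n)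
    have hind := indepFun_increment hW (hu n.le_succ) (u := fun j : Set.Iic n => u j)
      fun j => hu j.2
    have hm : Measurable fun w : Set.Iic n → ℝ => ∑ j : Fin n, c j *
        (w ⟨j + 1, j.2⟩ - w ⟨j, j.2.le⟩) := by fun_prop
    have hind' := hind.comp hm (measurable_const_mul (c n))
    have h2 : (fun ω => ∑ j ∈ Finset.range n, c j * (W (u (j + 1)) ω - W (u j) ω)) =
        (fun w : Set.Iic n → ℝ => ∑ j : Fin n, c j * (w ⟨j + 1, j.2⟩ - w ⟨j, j.2.le⟩)) ∘
          fun ω j => W (u j) ω := by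
      ext ω
      simp only [Function.comp]
      rw [Finset.sum_range]
    rw [← h2] at hind'
    have h3 := gaussianReal_add_gaussianReal_of_indepFun hind' ih.map_eq h1.map_eq
    refine ⟨ih.aemeasurable.add h1.aemeasurable, ?_⟩
    simpa [Pi.add_def, Function.comp_def] using h3

/-- Characteristic functions pass to the almost sure limit by dominated convergence, and the
Gaussian ones are continuous in the variance. -/
theorem hasLaw_of_tendsto [IsProbabilityMeasure P] {R : ℕ → Ω → ℝ} {J : Ω → ℝ} {v : ℕ → ℝ≥0}
    {v₀ : ℝ≥0} (hR : ∀ n, HasLaw (R n) (gaussianReal 0 (v n)) P) (hv : Tendsto v atTop (𝓝 v₀))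
    (hJ : ∀ᵐ ω ∂P, Tendsto (fun n => R n ω) atTop (𝓝 (J ω))) :
    HasLaw J (gaussianReal 0 v₀) P := by
  have hJm : AEMeasurable J P :=
    aemeasurable_of_tendsto_metrizable_ae atTop (fun n => (hR n).aemeasurable) hJ
  refine ⟨hJm, ?_⟩
  have := Measure.isProbabilityMeasure_map hJm
  refine Measure.ext_of_charFun (funext fun ξ => ?_)
  have e : ∀ {Z : Ω → ℝ}, AEMeasurable Z P →
      charFun (P.map Z) ξ = ∫ ω, Complex.exp (ξ * Z ω * Complex.I) ∂P := fun hZ => by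
    rw [charFun_apply_real, integral_map hZ (by fun_prop)]
  have h1 : Tendsto (fun n => charFun (P.map (R n)) ξ) atTop (𝓝 (charFun (P.map J) ξ)) := by
    rw [e hJm]
    simp_rw [fun n => e (hR n).aemeasurable]
    refine tendsto_integral_of_dominated_convergence (fun _ => (1 : ℝ)) (fun n => ?_)
      (integrable_const _) (fun n => ae_of_all _ fun ω => ?_) ?_
    · have := (hR n).aemeasurable
      exact AEMeasurable.aestronglyMeasurable (by fun_prop)
    · rw [← Complex.ofReal_mul, Complex.norm_exp_ofReal_mul_I]
    · filter_upwards [hJ] with ω hω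
      have : Continuous fun z : ℝ => Complex.exp (ξ * z * Complex.I) := by fun_prop
      exact (this.tendsto _).comp hω
  refine tendsto_nhds_unique h1 ?_
  simp_rw [(hR _).map_eq, charFun_gaussianReal]
  have : Continuous fun w : ℝ≥0 => Complex.exp (ξ * (0 : ℝ) * Complex.I - (w : ℝ) * ξ ^ 2 / 2) := by
    fun_prop
  exact (this.tendsto _).comp hv

theorem hasLaw_wienerIntegral (hW : IsBrownianReal W P) {t s : ℝ≥0} (hts : t ≤ s) (hs : s < 1) :
    HasLaw (wienerIntegral W t s)
      (gaussianReal 0 ((1 - (s : ℝ))⁻¹ - (1 - (t : ℝ))⁻¹).toNNReal) P := by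
  have := hW.isGaussianProcess.isProbabilityMeasure
  have hs1 : (s : ℝ) < 1 := by exact_mod_cast hs
  have hts' : (t : ℝ) ≤ s := hts
  refine hasLaw_of_tendsto (fun n => hasLaw_sum_increments hW.toIsPreBrownianReal
    (part_mono t s n) (fun j => (1 - (part t s n j : ℝ))⁻¹) n) ?_
    (hW.cont.mono fun ω hω => tendsto_wienerSum hω hts hs)
  have hle := NNReal.coe_le_coe.2 hts
  rw [← NNReal.tendsto_coe, Real.coe_toNNReal]
  -- The variances of the sums are left-endpoint Riemann sums of `∫ (1 - v)⁻² dv`, the Itô isometry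
  -- for this integrand.
  · have key := tendsto_riemannSum (g := fun v => ((1 - v) ^ 2)⁻¹) (h := fun _ => 1)
      (u := fun n j => part t s n j) (c := fun n j => part t s n j) hts'
      (continuousOn_inv_one_sub_sq hs1) continuousOn_const (fun n j => coe_part hts n j)
      (fun n j _ => ⟨le_rfl, NNReal.coe_le_coe.2 (part_mono t s n j.le_succ)⟩)
    simp only [mul_one] at key
    rw [integral_inv_one_sub_sq hts' hs1] at key
    refine key.congr fun n => ?_
    rw [NNReal.coe_sum]
    refine Finset.sum_congr rfl fun j _ => ?_
    rw [intervalIntegral.integral_const, NNReal.coe_mul,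
      NNReal.coe_sub (part_mono t s n j.le_succ)]
    simp
  · rw [sub_nonneg]
    gcongr

end Wiener

/-! ### Measurability and independence up to null sets. -/

section Augmentation

/-- The `limsup` is measurable for the small `σ`-algebra even where the sums diverge. A modification
is needed because paths are continuous only almost surely. -/
theorem exists_measurable_of_tendsto {Ω : Type*} {m mΩ : MeasurableSpace Ω} {P : Measure[mΩ] Ω}
    {R : ℕ → Ω → ℝ} {J : Ω → ℝ} (hR : ∀ n, Measurable[m] (R n))
    (hJ : ∀ᵐ ω ∂P, Tendsto (fun n => R n ω) atTop (𝓝 (J ω))) :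
    ∃ J' : Ω → ℝ, Measurable[m] J' ∧ J' =ᵐ[P] J :=
  ⟨fun ω => limsup (fun n => R n ω) atTop, Measurable.limsup hR,
    hJ.mono fun _ hω => hω.limsup_eq⟩

theorem indep_of_ae_eq {Ω : Type*} {m₁ m₁' m₂ m₂' mΩ : MeasurableSpace Ω} {P : Measure[mΩ] Ω}
    (h : Indep m₁ m₂ P)
    (h₁ : ∀ A, MeasurableSet[m₁'] A → ∃ B, MeasurableSet[m₁] B ∧ A =ᵐ[P] B)
    (h₂ : ∀ A, MeasurableSet[m₂'] A → ∃ B, MeasurableSet[m₂] B ∧ A =ᵐ[P] B) :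
    Indep m₁' m₂' P := by
  rw [Indep_iff] at h ⊢
  intro A C hA hC
  obtain ⟨A', hA', hAA'⟩ := h₁ A hA
  obtain ⟨C', hC', hCC'⟩ := h₂ C hC
  rw [measure_congr (hAA'.inter hCC'), measure_congr hAA', measure_congr hCC', h A' C' hA' hC']

end Augmentation

/-! ### The pinned bridge as a Markov chain in the augmented filtration. -/

section Bridge

variable {Ω : Type*} {mΩ : MeasurableSpace Ω} {P : Measure Ω} {W : ℝ≥0 → Ω → ℝ}

/-- Sets almost surely equal to a set of the natural filtration form a `σ`-algebra, and it contains
both generators. -/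
theorem augFiltration_ae_eq (hWm : ∀ t, Measurable (W t)) (t : ℝ≥0) {A : Set Ω}
    (hA : MeasurableSet[augFiltration P W hWm t] A) :
    ∃ B, MeasurableSet[Filtration.natural W (fun t => (hWm t).stronglyMeasurable) t] B ∧
      A =ᵐ[P] B := by
  have hle : augFiltration P W hWm t ≤ eventuallyMeasurableSpace
      (Filtration.natural W (fun t => (hWm t).stronglyMeasurable) t) (ae P) := by
    refine sup_le (le_eventuallyMeasurableSpace (m := _) (l := _)) ?_
    refine MeasurableSpace.generateFrom_le fun s hs => ⟨∅, @MeasurableSet.empty _ (_), ?_⟩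
    exact ae_eq_empty.2 hs.2
  exact hle A hA

theorem natural_le_augFiltration (hWm : ∀ t, Measurable (W t)) (t : ℝ≥0) :
    Filtration.natural W (fun t => (hWm t).stronglyMeasurable) t ≤ augFiltration P W hWm t :=
  le_sup_left (a := Filtration.natural W (fun t => (hWm t).stronglyMeasurable) t)

theorem measurable_natural (hWm : ∀ t, Measurable (W t)) {u t : ℝ≥0} (hu : u ≤ t) :
    Measurable[Filtration.natural W (fun t => (hWm t).stronglyMeasurable) t] (W u) :=
  ((Filtration.stronglyAdapted_natural (u := W)
    fun t => (hWm t).stronglyMeasurable) u).measurable.mono (Filtration.mono _ hu) le_rfl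

theorem measurable_wienerSum {m : MeasurableSpace Ω} {t s : ℝ≥0} (n : ℕ)
    (h : ∀ i j, i ≤ n → j ≤ n → Measurable[m] fun ω =>
      W (part t s n j) ω - W (part t s n i) ω) :
    Measurable[m] (wienerSum W t s n) := by
  unfold wienerSum
  refine Finset.measurable_fun_sum _ fun j hj => ?_
  rw [Finset.mem_range] at hj
  exact (h j (j + 1) hj.le hj).const_mul _

theorem exists_measurable_wienerIntegral (hW : IsBrownianReal W P) (hWm : ∀ t, Measurable (W t))
    {t s : ℝ≥0} (hts : t ≤ s) (hs : s < 1) :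
    ∃ J : Ω → ℝ, Measurable[Filtration.natural W (fun t => (hWm t).stronglyMeasurable) s] J ∧
      J =ᵐ[P] wienerIntegral W t s :=
  exists_measurable_of_tendsto (fun n => measurable_wienerSum n fun _ _ hi hj =>
    (measurable_natural hWm (part_le hts hj)).sub (measurable_natural hWm (part_le hts hi)))
    (hW.cont.mono fun _ hω => tendsto_wienerSum hω hts hs)

/-- The Riemann sums use only increments after `t`, which are independent of the natural past; null
modifications on both sides do no harm. -/
theorem indep_wienerIntegral (hW : IsBrownianReal W P) (hWm : ∀ t, Measurable (W t))
    {t s : ℝ≥0} (hts : t ≤ s) (hs : s < 1) :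
    Indep (augFiltration P W hWm t)
      (MeasurableSpace.comap (wienerIntegral W t s) inferInstance) P := by
  set m : MeasurableSpace Ω :=
    MeasurableSpace.comap (fun ω u => W (t + u) ω - W t ω) inferInstance with hm
  have hmeas : ∀ u, t ≤ u → Measurable[m] fun ω => W u ω - W t ω := fun u hu => by
    have h1 : Measurable[m] fun ω u => W (t + u) ω - W t ω := comap_measurable _
    have h2 := (measurable_pi_apply (u - t)).comp h1
    simpa [Function.comp_def, add_tsub_cancel_of_le hu] using h2
  obtain ⟨J, hJ, hJW⟩ := exists_measurable_of_tendsto (m := m) (fun n => measurable_wienerSum n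
    fun i j _ _ => by
      have := (hmeas _ (le_part t s n j)).sub (hmeas _ (le_part t s n i))
      simpa [Pi.sub_def] using this)
    (hW.cont.mono fun _ hω => tendsto_wienerSum hω hts hs)
  have hind : Indep (Filtration.natural W (fun t => (hWm t).stronglyMeasurable) t) m P := by
    rw [Filtration.natural_eq_comap]
    exact (hW.indepFun_shift t).symm
  refine indep_of_ae_eq hind (fun A hA => augFiltration_ae_eq hWm t hA) ?_
  rintro _ ⟨C, hC, rfl⟩
  refine ⟨J ⁻¹' C, hJ hC, ?_⟩
  filter_upwards [hJW] with ω hω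
  simp only [eq_iff_iff]
  change wienerIntegral W t s ω ∈ C ↔ J ω ∈ C
  rw [hω]

theorem wienerIntegral_self (t : ℝ≥0) (ω : Ω) : wienerIntegral W t t ω = 0 := by
  simp [wienerIntegral]

theorem bridge_eq {t s : ℝ≥0} (hts : t ≤ s) (ht : t < 1) (x : ℝ) (ω : Ω) :
    bridge W t x s ω = (1 - (s : ℝ)) * (x / (1 - (t : ℝ)) + wienerIntegral W t s ω) := by
  unfold bridge
  split_ifs with h
  · obtain rfl : s = t := le_antisymm h hts
    have : (1 : ℝ) - s ≠ 0 := by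
      have : (s : ℝ) < 1 := by exact_mod_cast ht
      linarith
    rw [wienerIntegral_self]
    field_simp
    ring
  · rfl

theorem continuousOn_wienerIntegrand {ω : Ω} (hω : Continuous (W · ω)) {a b : ℝ} (hb : b < 1) :
    ContinuousOn (fun u : ℝ => W u.toNNReal ω / (1 - u) ^ 2) (Set.Icc a b) := by
  have h := ((hω.comp continuous_real_toNNReal).continuousOn (s := Set.Icc a b)).mul
    (continuousOn_inv_one_sub_sq (a := a) hb)
  exact h

theorem wienerIntegral_add {ω : Ω} (hω : Continuous (W · ω)) {t s s' : ℝ≥0} (hts : t ≤ s)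
    (hss' : s ≤ s') (hs' : s' < 1) :
    wienerIntegral W t s ω + wienerIntegral W s s' ω = wienerIntegral W t s' ω := by
  have h1 : (s' : ℝ) < 1 := by exact_mod_cast hs'
  have h2 : (s : ℝ) ≤ s' := hss'
  have i1 := (continuousOn_wienerIntegrand (a := t) hω (h2.trans_lt h1)).intervalIntegrable_of_Icc
    (μ := volume) (NNReal.coe_le_coe.2 hts)
  have i2 := (continuousOn_wienerIntegrand (a := s) hω h1).intervalIntegrable_of_Icc
    (μ := volume) h2
  unfold wienerIntegral
  rw [← intervalIntegral.integral_add_adjacent_intervals i1 i2]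
  ring

theorem bridge_step {ω : Ω} (hω : Continuous (W · ω)) {t s s' : ℝ≥0} (hts : t ≤ s)
    (hss' : s ≤ s') (hs : s < 1) (hs' : s' ≤ 1) (x : ℝ) :
    bridge W t x s' ω = (1 - (s' : ℝ)) / (1 - s) * bridge W t x s ω +
      (1 - (s' : ℝ)) * wienerIntegral W s s' ω := by
  have ht := hts.trans_lt hs
  have : (1 : ℝ) - s ≠ 0 := by
    have : (s : ℝ) < 1 := by exact_mod_cast hs
    linarith
  rw [bridge_eq hts ht, bridge_eq (hts.trans hss') ht]
  rcases hs'.eq_or_lt with rfl | h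
  · simp
  · rw [← wienerIntegral_add hω hts hss' h]
    field_simp
    ring

theorem exists_measurable_bridge (hW : IsBrownianReal W P) (hWm : ∀ t, Measurable (W t))
    {t s : ℝ≥0} (hts : t ≤ s) (ht : t < 1) (hs : s ≤ 1) (x : ℝ) :
    ∃ X : Ω → ℝ, Measurable[augFiltration P W hWm s] X ∧ X =ᵐ[P] bridge W t x s := by
  rcases hs.eq_or_lt with rfl | h
  · refine ⟨fun _ => 0, measurable_const, ae_of_all _ fun ω => ?_⟩
    rw [bridge_eq hts ht]; simp
  · obtain ⟨J, hJ, hJW⟩ := exists_measurable_wienerIntegral hW hWm hts h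
    refine ⟨fun ω => (1 - (s : ℝ)) * (x / (1 - (t : ℝ)) + J ω),
      ((hJ.mono (natural_le_augFiltration hWm s) le_rfl).const_add _).const_mul _, ?_⟩
    filter_upwards [hJW] with ω hω
    rw [bridge_eq hts ht, hω]

theorem hasLaw_bridge_innovation (hW : IsBrownianReal W P) {s s' : ℝ≥0} (hss' : s ≤ s')
    (hs : s < 1) (hs' : s' ≤ 1) :
    HasLaw (fun ω => (1 - (s' : ℝ)) * wienerIntegral W s s' ω)
      (gaussianReal 0 ((1 - (s' : ℝ)) * (s' - s) / (1 - s)).toNNReal) P := by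
  have := hW.isGaussianProcess.isProbabilityMeasure
  rcases hs'.eq_or_lt with rfl | h
  · simp only [NNReal.coe_one, sub_self, zero_mul, zero_div, Real.toNNReal_zero,
      gaussianReal_zero_var]
    exact ⟨aemeasurable_const, by simp⟩
  · have h1 : (s' : ℝ) < 1 := by exact_mod_cast h
    have h2 : (s : ℝ) ≤ s' := hss'
    have h3 : 0 < 1 - (s' : ℝ) := by linarith
    have h4 : 0 < 1 - (s : ℝ) := by linarith
    convert gaussianReal_const_mul (hasLaw_wienerIntegral hW hss' h) (1 - (s' : ℝ)) using 2
    · simp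
    · have h5 : (1 - (s : ℝ))⁻¹ ≤ (1 - (s' : ℝ))⁻¹ := by gcongr
      ext
      rw [Real.coe_toNNReal _ (by have := sub_nonneg.2 h2; positivity), NNReal.coe_mul,
        Real.coe_toNNReal _ (sub_nonneg.2 h5)]
      simp only [NNReal.coe_mk]
      field_simp
      ring

theorem indep_bridge_innovation (hW : IsBrownianReal W P) (hWm : ∀ t, Measurable (W t))
    {s s' : ℝ≥0} (hss' : s ≤ s') (hs' : s' ≤ 1) :
    Indep (augFiltration P W hWm s) (MeasurableSpace.comap
      (fun ω => (1 - (s' : ℝ)) * wienerIntegral W s s' ω) inferInstance) P := by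
  have := hW.isGaussianProcess.isProbabilityMeasure
  rcases hs'.eq_or_lt with rfl | h
  · simp only [NNReal.coe_one, sub_self, zero_mul, MeasurableSpace.comap_const]
    exact indep_bot_right _
  · refine indep_of_indep_of_le_right (indep_wienerIntegral hW hWm hss' h) ?_
    have : Measurable[MeasurableSpace.comap (wienerIntegral W s s') inferInstance]
        fun ω => (1 - (s' : ℝ)) * wienerIntegral W s s' ω :=
      (comap_measurable (wienerIntegral W s s')).const_mul _
    exact this.comap_le

/-- The grid `t + (1 - t) k / n` of `[t, 1]`. -/
noncomputable def timeGrid (t : ℝ≥0) (n k : ℕ) : ℝ≥0 := part t 1 n k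

/-- The augmented filtration sampled on the grid of `[t, 1]`. -/
noncomputable def sampledFiltration (P : Measure Ω) (W : ℝ≥0 → Ω → ℝ)
    (hWm : ∀ t, Measurable (W t)) (t : ℝ≥0) (n : ℕ) : Filtration ℕ mΩ where
  seq k := augFiltration P W hWm (timeGrid t n k)
  mono' _ _ h := (augFiltration P W hWm).mono (part_mono t 1 n h)
  le' _ := (augFiltration P W hWm).le _

theorem timeGrid_lt_one {t : ℝ≥0} (ht : t < 1) {n k : ℕ} (hk : k < n) : timeGrid t n k < 1 := by
  have h := grid_lt_one hk
  calc timeGrid t n k = t + (1 - t) * (k / n) := rfl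
    _ < t + (1 - t) * 1 := by
        gcongr
        exact tsub_pos_of_lt ht
    _ = 1 := by rw [mul_one, add_tsub_cancel_of_le ht.le]

theorem one_sub_timeGrid {t : ℝ≥0} (ht : t < 1) (n k : ℕ) :
    1 - (timeGrid t n k : ℝ) = (1 - t) * (1 - k / n) := by
  rw [timeGrid, coe_part ht.le]; push_cast; ring

/-- The factor `1 - t` cancels from the coefficients and multiplies the innovation variances, so the
transitions are those of `sampledBridge` with volatility `√(1 - t)`. -/
theorem exists_chain_bridge (hW : IsBrownianReal W P) (hWm : ∀ t, Measurable (W t)) {t : ℝ≥0}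
    (ht : t < 1) (n : ℕ) (x : ℝ) :
    ∃ X : ℕ → Ω → ℝ, (∀ k, Measurable (X k)) ∧
      (∀ k ≤ n, X k =ᵐ[P] bridge W t x (timeGrid t n k)) ∧
      IsGaussianChain P (sampledFiltration P W hWm t n) (bridgeCoef n)
        (bridgeVar (NNReal.sqrt (1 - t)) n) n X := by
  have := hW.isGaussianProcess.isProbabilityMeasure
  have hex : ∀ k, ∃ X : Ω → ℝ, Measurable[augFiltration P W hWm (timeGrid t n k)] X ∧
      (k ≤ n → X =ᵐ[P] bridge W t x (timeGrid t n k)) := fun k => by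
    by_cases hk : k ≤ n
    · obtain ⟨X, h1, h2⟩ := exists_measurable_bridge hW hWm (le_part t 1 n k) ht
        (part_le ht.le hk) x
      exact ⟨X, h1, fun _ => h2⟩
    · exact ⟨fun _ => 0, measurable_const, fun h => absurd h hk⟩
  choose X hXm hXb using hex
  refine ⟨X, fun k => (hXm k).mono ((augFiltration P W hWm).le _) le_rfl, fun k hk => hXb k hk,
    fun k _ => hXm k, fun k hk A hA h hh => ?_⟩
  have h1 : timeGrid t n k ≤ timeGrid t n (k + 1) := part_mono t 1 n k.le_succ
  have h2 : timeGrid t n (k + 1) ≤ 1 := part_le ht.le hk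
  have h3 : timeGrid t n k < 1 := timeGrid_lt_one ht hk
  have ht' : (1 : ℝ) - t ≠ 0 := by
    have : (t : ℝ) < 1 := by exact_mod_cast ht
    linarith
  refine lintegral_gaussStep_of_indep ((sampledFiltration P W hWm t n).le k) (hXm k)
    (N := fun ω => (1 - (timeGrid t n (k + 1) : ℝ)) *
      wienerIntegral W (timeGrid t n k) (timeGrid t n (k + 1)) ω) ?_ ?_ ?_ hA hh
  · convert hasLaw_bridge_innovation hW h1 h3 h2 using 2
    have e : (timeGrid t n (k + 1) : ℝ) - timeGrid t n k =
        (1 - t) * ((k + 1 : ℕ) / n - k / n) := by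
      rw [timeGrid, timeGrid, coe_part ht.le, coe_part ht.le]; push_cast; ring
    have e2 : (1 - (t : ℝ)) = ((1 - t : ℝ≥0) : ℝ) := by rw [NNReal.coe_sub ht.le]; rfl
    rw [one_sub_timeGrid ht, one_sub_timeGrid ht, e, bridgeVar, NNReal.sq_sqrt,
      ← Real.toNNReal_coe (r := 1 - t), ← Real.toNNReal_mul NNReal.zero_le_coe, ← e2]
    congr 1
    field_simp
  · intro Z hZ
    exact indepFun_of_measurable (indep_bridge_innovation hW hWm h1 h2) hZ
  · filter_upwards [hXb k hk.le, hXb (k + 1) hk, hW.cont] with ω hω1 hω2 hωc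
    rw [hω1, hω2, bridge_step hωc (s := timeGrid t n k) (le_part t 1 n k) h1 h3 h2 x, one_sub_timeGrid ht,
      one_sub_timeGrid ht, mul_div_mul_left _ _ ht', bridgeCoef]

end Bridge

/-! ### The value function as a supremum of grid values, and its bounds. -/

section Value

variable {Ω : Type*} {mΩ : MeasurableSpace Ω} {P : Measure Ω} {W : ℝ≥0 → Ω → ℝ}

theorem tendsto_bridge {ω : Ω} (hω : Continuous (W · ω)) {t s : ℝ≥0} (hts : t ≤ s) (hs : s < 1)
    (x : ℝ) {u : ℕ → ℝ≥0} (hu : ∀ n, s ≤ u n) (hlim : Tendsto u atTop (𝓝 s)) :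
    Tendsto (fun n => bridge W t x (u n) ω) atTop (𝓝 (bridge W t x s ω)) := by
  have ht := hts.trans_lt hs
  have hs1 : (s : ℝ) < 1 := by exact_mod_cast hs
  have hts' : (t : ℝ) ≤ s := hts
  -- Staying below some `b < 1` avoids the singularity of the integrand at `1`.
  obtain ⟨b, hsb, hb⟩ := exists_between hs1
  simp_rw [bridge_eq (hts.trans (hu _)) ht, bridge_eq hts ht]
  have hlim' : Tendsto (fun n => (u n : ℝ)) atTop (𝓝 (s : ℝ)) := NNReal.tendsto_coe.2 hlim
  have hint := (continuousOn_wienerIntegrand (a := t) hω hb).intervalIntegrable_of_Icc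
    (μ := volume) (hts'.trans hsb.le)
  have hprim := intervalIntegral.continuousOn_primitive_interval' hint Set.left_mem_uIcc
  rw [Set.uIcc_of_le (hts'.trans hsb.le)] at hprim
  have hI : Tendsto (fun n => ∫ v in (t : ℝ)..(u n : ℝ), W v.toNNReal ω / (1 - v) ^ 2) atTop
      (𝓝 (∫ v in (t : ℝ)..(s : ℝ), W v.toNNReal ω / (1 - v) ^ 2)) := by
    refine (hprim s ⟨hts', hsb.le⟩).tendsto.comp (tendsto_nhdsWithin_iff.2 ⟨hlim', ?_⟩)
    filter_upwards [hlim'.eventually_le_const hsb] with n hn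
    exact ⟨hts'.trans (NNReal.coe_le_coe.2 (hu n)), hn⟩
  have h1 := hlim'.const_sub 1
  refine h1.mul (Tendsto.const_add _ ?_)
  unfold wienerIntegral
  exact ((((hω.tendsto s).comp hlim).div h1 (by linarith)).sub_const _).sub hI

/-- The index of the first grid point of `[t, 1]` after `t + τ`. -/
noncomputable def gridIndex (t : ℝ≥0) (n : ℕ) (r : ℝ≥0) : ℕ := ⌈r / (1 - t) * n⌉₊

theorem gridIndex_le {t r : ℝ≥0} (hr : t + r ≤ 1) (n : ℕ) : gridIndex t n r ≤ n := by
  refine Nat.ceil_le.2 (mul_le_of_le_one_left (by positivity) ?_)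
  exact div_le_one_of_le₀ (le_tsub_of_add_le_left hr) (by positivity)

theorem gridIndex_le_iff {t r : ℝ≥0} (ht : t < 1) {n : ℕ} (hn : 0 < n) (j : ℕ) :
    gridIndex t n r ≤ j ↔ t + r ≤ timeGrid t n j := by
  have h1 : 0 < 1 - t := tsub_pos_of_lt ht
  have h2 : (0 : ℝ≥0) < n := by exact_mod_cast hn
  rw [gridIndex, Nat.ceil_le, timeGrid, part, add_le_add_iff_left, ← le_div_iff₀ h2,
    div_le_iff₀ h1, mul_comm]

theorem tendsto_timeGrid_gridIndex {t r : ℝ≥0} (ht : t < 1) :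
    Tendsto (fun n : ℕ => timeGrid t (n + 1) (gridIndex t (n + 1) r)) atTop (𝓝 (t + r)) := by
  have h : Tendsto (fun n : ℕ => ((⌈r / (1 - t) * n⌉₊ : ℕ) / n : ℝ≥0)) atTop
      (𝓝 (r / (1 - t))) := by
    have := (tendsto_nat_ceil_mul_div_atTop (R := ℝ) (r / (1 - t)).2).comp
      tendsto_natCast_atTop_atTop
    rw [← NNReal.tendsto_coe]
    refine this.congr fun n => ?_
    simp only [Function.comp]
    push_cast
    congr 2
  have h2 := ((h.comp (tendsto_add_atTop_nat 1)).const_mul (1 - t)).const_add t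
  rw [mul_div_cancel₀ _ (tsub_pos_of_lt ht).ne'] at h2
  exact h2

variable {hWm : ∀ t, Measurable (W t)}

theorem IsAdmissible.isDiscreteStopping {t : ℝ≥0} (ht : t < 1) {τ : Ω → ℝ≥0}
    (hτ : IsAdmissible P W hWm t τ) {n : ℕ} (hn : 0 < n) :
    IsDiscreteStopping (sampledFiltration P W hWm t n) fun ω => gridIndex t n (τ ω) := fun j => by
  simp_rw [gridIndex_le_iff ht hn]
  have := hτ.2 (timeGrid t n j)
  simp only [WithTop.coe_le_coe] at this
  exact this

/-- Times rounded up equal `1` once `t + r = 1`, so continuity of the bridge at its pinned end is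
never needed. -/
theorem tendsto_payoff {ω : Ω} (hω : Continuous (W · ω)) {t r : ℝ≥0} (ht : t < 1)
    (hr : t + r ≤ 1) (x : ℝ) :
    Tendsto (fun n : ℕ => bridge W t x (timeGrid t (n + 1) (gridIndex t (n + 1) r)) ω) atTop
      (𝓝 (bridge W t x (t + r) ω)) := by
  have hge : ∀ n : ℕ, t + r ≤ timeGrid t (n + 1) (gridIndex t (n + 1) r) := fun n =>
    (gridIndex_le_iff ht n.succ_pos _).1 le_rfl
  rcases hr.eq_or_lt with h | h
  · refine tendsto_const_nhds.congr fun n => ?_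
    have h1 := hge n
    have h2 : timeGrid t (n + 1) (gridIndex t (n + 1) r) ≤ 1 := part_le ht.le (gridIndex_le hr _)
    rw [h] at h1 ⊢
    rw [le_antisymm h2 h1]
  · exact tendsto_bridge hω le_self_add h x hge (tendsto_timeGrid_gridIndex ht)

theorem measurable_eval_index {X : ℕ → Ω → ℝ} (hX : ∀ k, Measurable (X k)) {σ : Ω → ℕ}
    (hσ : Measurable σ) : Measurable fun ω => X (σ ω) ω :=
  (measurable_from_prod_countable_right (f := fun p : ℕ × Ω => X p.1 p.2) hX).comp
    (hσ.prodMk measurable_id)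

/-- The stopping value of the bridge with volatility `c`, over all uniform grids. -/
noncomputable def bridgeValue (c : ℝ≥0) (x : ℝ) : ℝ≥0∞ := ⨆ n : ℕ, gridValue c (n + 1) x

/-- Rounded up to the grid, `t + τ` is a stopping time of the sampled filtration; the payoffs
converge and Fatou's lemma gives the bound without any domination. -/
theorem IsAdmissible.lintegral_le (hW : IsBrownianReal W P) {t : ℝ≥0} (ht : t < 1) (x : ℝ)
    {τ : Ω → ℝ≥0} (hτ : IsAdmissible P W hWm t τ) :
    AEMeasurable (payoff W t x τ) P ∧
      ∫⁻ ω, ENNReal.ofReal (payoff W t x τ ω) ∂P ≤ bridgeValue (NNReal.sqrt (1 - t)) x := by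
  have := hW.isGaussianProcess.isProbabilityMeasure
  choose X hXm hXb hXc using fun n : ℕ => exists_chain_bridge hW hWm ht (n + 1) x
  have hσ := fun n : ℕ => hτ.isDiscreteStopping ht n.succ_pos
  set f : ℕ → Ω → ℝ := fun n ω => Real.exp (X n (gridIndex t (n + 1) (τ ω)) ω) with hf
  have hfm : ∀ n, Measurable (f n) := fun n =>
    Real.measurable_exp.comp (measurable_eval_index (hXm n) (hσ n).measurable)
  have hXb' : ∀ᵐ ω ∂P, ∀ n, ∀ k ≤ n + 1, X n k ω = bridge W t x (timeGrid t (n + 1) k) ω := by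
    rw [ae_all_iff]; intro n
    rw [ae_all_iff]; intro k
    by_cases hk : k ≤ n + 1
    · filter_upwards [hXb n k hk] with ω hω _ using hω
    · exact ae_of_all _ fun ω h => absurd h hk
  have hlim : ∀ᵐ ω ∂P, Tendsto (fun n => f n ω) atTop (𝓝 (payoff W t x τ ω)) := by
    filter_upwards [hXb', hW.cont] with ω hω hωc
    refine (Real.continuous_exp.tendsto _).comp ?_
    refine (tendsto_payoff hωc ht (hτ.1 ω) x).congr fun n => ?_
    exact (hω n _ (gridIndex_le (hτ.1 ω) _)).symm
  refine ⟨aemeasurable_of_tendsto_metrizable_ae atTop (fun n => (hfm n).aemeasurable) hlim, ?_⟩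
  calc ∫⁻ ω, ENNReal.ofReal (payoff W t x τ ω) ∂P
      = ∫⁻ ω, liminf (fun n => ENNReal.ofReal (f n ω)) atTop ∂P := by
        refine lintegral_congr_ae ?_
        filter_upwards [hlim] with ω hω
        exact ((ENNReal.continuous_ofReal.tendsto _).comp hω).liminf_eq.symm
    _ ≤ liminf (fun n => ∫⁻ ω, ENNReal.ofReal (f n ω) ∂P) atTop :=
        lintegral_liminf_le fun n => (hfm n).ennreal_ofReal
    _ ≤ bridgeValue (NNReal.sqrt (1 - t)) x := by
        refine liminf_le_of_le (by isBoundedDefault) fun b hb => ?_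
        obtain ⟨n, hn⟩ := hb.exists
        refine hn.trans (le_trans ?_ (le_iSup _ n))
        refine ((hXc n).lintegral_le_snell (g := fun y => ENNReal.ofReal (Real.exp y))
          (by fun_prop) (hσ n) fun ω => gridIndex_le (hτ.1 ω) _).trans ?_
        refine (lintegral_mono_ae
          (g := fun _ => gridValue (NNReal.sqrt (1 - t)) (n + 1) x) ?_).trans (by simp)
        filter_upwards [hXb n 0 (Nat.zero_le _)] with ω hω
        rw [hω]
        simp [timeGrid, part, bridge, gridValue]

/-- An optimal rule on the grid, read in continuous time, is admissible: before any `i` only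
decisions at grid times up to `i` matter. -/
theorem exists_admissible_ge (hW : IsBrownianReal W P) {t : ℝ≥0} (ht : t < 1) (x : ℝ) {n : ℕ} :
    ∃ τ : Ω → ℝ≥0, IsAdmissible P W hWm t τ ∧
      gridValue (NNReal.sqrt (1 - t)) n x ≤ ∫⁻ ω, ENNReal.ofReal (payoff W t x τ ω) ∂P := by
  have := hW.isGaussianProcess.isProbabilityMeasure
  obtain ⟨X, hXm, hXb, hXc⟩ := exists_chain_bridge hW hWm ht n x
  obtain ⟨σ, hσ, hσn, hle⟩ := hXc.exists_stopping (g := fun y => ENNReal.ofReal (Real.exp y))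
    (by fun_prop)
  have hτ : ∀ ω, t + (1 - t) * ((σ ω : ℝ≥0) / n) = timeGrid t n (σ ω) := fun _ => rfl
  refine ⟨fun ω => (1 - t) * ((σ ω : ℝ≥0) / n), ⟨fun ω => ?_, fun i => ?_⟩, ?_⟩
  · rw [hτ]; exact part_le ht.le (hσn ω)
  · simp_rw [hτ, WithTop.coe_le_coe]
    have : {ω | timeGrid t n (σ ω) ≤ i} = ⋃ k, ⋃ _ : timeGrid t n k ≤ i, {ω | σ ω ≤ k} := by
      ext ω
      simp only [Set.mem_ofPred_eq, Set.mem_iUnion, exists_prop]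
      exact ⟨fun h => ⟨σ ω, h, le_rfl⟩, fun ⟨k, hk, h⟩ => (part_mono t 1 n h).trans hk⟩
    rw [this]
    exact MeasurableSet.iUnion fun k => MeasurableSet.iUnion fun hk =>
      (augFiltration P W hWm).mono hk _ (hσ k)
  · have e1 : gridValue (NNReal.sqrt (1 - t)) n x ≤ ∫⁻ ω, snell
        (fun y => ENNReal.ofReal (Real.exp y)) (bridgeCoef n)
        (bridgeVar (NNReal.sqrt (1 - t)) n) 0 n (X 0 ω) ∂P := by
      refine le_trans (by simp [gridValue]) (lintegral_mono_ae
        (f := fun _ => gridValue (NNReal.sqrt (1 - t)) n x) ?_)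
      filter_upwards [hXb 0 (Nat.zero_le _)] with ω hω
      rw [hω]
      simp [timeGrid, part, bridge, gridValue]
    refine e1.trans (hle.trans (lintegral_mono_ae ?_))
    have hXb' : ∀ᵐ ω ∂P, ∀ k ≤ n, X k ω = bridge W t x (timeGrid t n k) ω := by
      rw [ae_all_iff]; intro k
      by_cases hk : k ≤ n
      · filter_upwards [hXb k hk] with ω hω _ using hω
      · exact ae_of_all _ fun ω h => absurd h hk
    filter_upwards [hXb'] with ω hω
    rw [hω _ (hσn ω), payoff, hτ]

theorem bridgeValue_le_add (hW : IsBrownianReal W P) (hWm : ∀ t, Measurable (W t)) {c : ℝ≥0}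
    (hc : c ≤ 1) (d : ℝ≥0) (x : ℝ) :
    bridgeValue c x ≤ bridgeValue d x +
      ENNReal.ofReal (|(c : ℝ) - d| * Real.exp |x| * c2 P W) := by
  refine iSup_le fun n => (gridValue_le_add hW hWm hc d (n + 1) x).trans ?_
  rw [← ofReal_c2 hW hWm, ← ENNReal.ofReal_mul (by positivity)]
  gcongr
  exact le_iSup (fun n : ℕ => gridValue d (n + 1) x) n

theorem bridgeValue_le (hW : IsBrownianReal W P) (hWm : ∀ t, Measurable (W t)) {c : ℝ≥0}
    (hc : c ≤ 1) (x : ℝ) :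
    bridgeValue c x ≤ ENNReal.ofReal (Real.exp |x| + c * Real.exp |x| * c2 P W) := by
  have h := bridgeValue_le_add hW hWm hc 0 x
  have hc2 := c2_pos hW hWm
  rw [ENNReal.ofReal_add (by positivity) (by positivity)]
  refine h.trans (add_le_add ?_ (by simp))
  exact iSup_le fun n => gridValue_zero_le hW.toIsPreBrownianReal hWm (n + 1) x

theorem bridgeValue_ne_top (hW : IsBrownianReal W P) (hWm : ∀ t, Measurable (W t)) {c : ℝ≥0}
    (hc : c ≤ 1) (x : ℝ) : bridgeValue c x ≠ ∞ :=
  ((bridgeValue_le hW hWm hc x).trans_lt ENNReal.ofReal_lt_top).ne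

theorem payoff_pos (t : ℝ≥0) (x : ℝ) (τ : Ω → ℝ≥0) (ω : Ω) : 0 < payoff W t x τ ω :=
  Real.exp_pos _

theorem sqrt_one_sub_le_one (t : ℝ≥0) : NNReal.sqrt (1 - t) ≤ 1 :=
  NNReal.sqrt_le_one.2 tsub_le_self

theorem IsAdmissible.integrable (hW : IsBrownianReal W P) {t : ℝ≥0} (ht : t < 1) (x : ℝ)
    {τ : Ω → ℝ≥0} (hτ : IsAdmissible P W hWm t τ) : Integrable (payoff W t x τ) P := by
  obtain ⟨h1, h2⟩ := hτ.lintegral_le hW ht x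
  refine ⟨h1.aestronglyMeasurable, ?_⟩
  rw [hasFiniteIntegral_iff_ofReal (ae_of_all _ fun ω => (payoff_pos t x τ ω).le)]
  exact h2.trans_lt (bridgeValue_ne_top hW hWm (sqrt_one_sub_le_one t) x).lt_top

theorem isLUB_expectedPayoffs (hW : IsBrownianReal W P) {t : ℝ≥0} (ht : t < 1) (x : ℝ) :
    IsLUB (expectedPayoffs P W hWm t x) (bridgeValue (NNReal.sqrt (1 - t)) x).toReal := by
  have hfin := bridgeValue_ne_top hW hWm (sqrt_one_sub_le_one t) x
  have heq : ∀ τ, ENNReal.ofReal (∫ ω, payoff W t x τ ω ∂P) =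
      ∫⁻ ω, ENNReal.ofReal (payoff W t x τ ω) ∂P ∨ ¬ Integrable (payoff W t x τ) P := fun τ => by
    by_cases h : Integrable (payoff W t x τ) P
    · exact Or.inl (ofReal_integral_eq_lintegral_ofReal h
        (ae_of_all _ fun ω => (payoff_pos t x τ ω).le))
    · exact Or.inr h
  constructor
  · rintro _ ⟨τ, hτ, rfl⟩
    have h := (heq τ).resolve_right (not_not.2 (hτ.integrable hW ht x))
    exact (ENNReal.ofReal_le_iff_le_toReal hfin).1 (h.le.trans (hτ.lintegral_le hW ht x).2)
  · intro y hy
    have hle : bridgeValue (NNReal.sqrt (1 - t)) x ≤ ENNReal.ofReal y := by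
      refine iSup_le fun n => ?_
      obtain ⟨τ, hτ, hn⟩ := exists_admissible_ge (hWm := hWm) hW ht x (n := n + 1)
      have h := (heq τ).resolve_right (not_not.2 (hτ.integrable hW ht x))
      rw [← h] at hn
      exact hn.trans (ENNReal.ofReal_le_ofReal (hy ⟨τ, hτ, rfl⟩))
    -- Needed because `ENNReal.ofReal` truncates negative numbers to `0`.
    have hy0 : 0 ≤ y := by
      obtain ⟨τ, hτ, -⟩ := exists_admissible_ge (hWm := hWm) hW ht x (n := 1)
      exact (integral_nonneg fun ω => (payoff_pos t x τ ω).le).trans (hy ⟨τ, hτ, rfl⟩)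
    exact ENNReal.toReal_le_of_le_ofReal hy0 hle

theorem isAdmissible_const {t r : ℝ≥0} (h : t + r ≤ 1) :
    IsAdmissible P W hWm t fun _ => r :=
  ⟨fun _ => h, isStoppingTime_const _ _⟩

theorem expectedPayoffs_nonempty {t : ℝ≥0} (ht : t ≤ 1) (x : ℝ) :
    (expectedPayoffs P W hWm t x).Nonempty :=
  ⟨_, fun _ => 0, isAdmissible_const (by simpa using ht), rfl⟩

theorem value_eq (hW : IsBrownianReal W P) {t : ℝ≥0} (ht : t < 1) (x : ℝ) :
    value P W hWm t x = (bridgeValue (NNReal.sqrt (1 - t)) x).toReal :=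
  (isLUB_expectedPayoffs hW ht x).csSup_eq (expectedPayoffs_nonempty ht.le x)

theorem payoff_zero (t : ℝ≥0) (x : ℝ) (ω : Ω) :
    payoff W t x (fun _ => 0) ω = Real.exp x := by
  simp [payoff, bridge]

theorem IsAdmissible.eq_zero {τ : Ω → ℝ≥0} (hτ : IsAdmissible P W hWm 1 τ) : τ = fun _ => 0 := by
  ext ω
  have := hτ.1 ω
  simpa using this

theorem expectedPayoffs_one [IsProbabilityMeasure P] (x : ℝ) :
    expectedPayoffs P W hWm 1 x = {Real.exp x} := by
  ext r
  constructor
  · rintro ⟨τ, hτ, rfl⟩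
    rw [hτ.eq_zero]
    simp [payoff_zero]
  · rintro rfl
    exact ⟨fun _ => 0, isAdmissible_const (by simp), by simp [payoff_zero]⟩

theorem le_value (hW : IsBrownianReal W P) {t : ℝ≥0} (ht : t < 1) (x : ℝ) {τ : Ω → ℝ≥0}
    (hτ : IsAdmissible P W hWm t τ) : ∫ ω, payoff W t x τ ω ∂P ≤ value P W hWm t x := by
  rw [value_eq hW ht]
  exact (isLUB_expectedPayoffs hW ht x).1 ⟨τ, hτ, rfl⟩

theorem exp_le_value (hW : IsBrownianReal W P) {t : ℝ≥0} (ht : t < 1) (x : ℝ) :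
    Real.exp x ≤ value P W hWm t x := by
  have := hW.isGaussianProcess.isProbabilityMeasure
  have h := le_value hW ht x (isAdmissible_const (hWm := hWm) (P := P) (W := W) (r := 0)
    (by simpa using ht.le))
  simpa [payoff_zero] using h

theorem one_le_value (hW : IsBrownianReal W P) {t : ℝ≥0} (ht : t < 1) (x : ℝ) :
    1 ≤ value P W hWm t x := by
  have := hW.isGaussianProcess.isProbabilityMeasure
  have e := add_tsub_cancel_of_le ht.le
  have h := le_value hW ht x (isAdmissible_const (hWm := hWm) (P := P) (W := W) (r := 1 - t) e.le)
  have e2 : ∀ ω, payoff W t x (fun _ => 1 - t) ω = 1 := fun ω => by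
    rw [payoff, e, bridge_eq ht.le ht]; simp
  simpa [e2] using h

theorem value_sub_le (hW : IsBrownianReal W P) {s t : ℝ≥0} (hs : s < 1) (ht : t < 1) (x : ℝ) :
    value P W hWm s x - value P W hWm t x ≤
      |√(1 - (s : ℝ)) - √(1 - (t : ℝ))| * Real.exp |x| * c2 P W := by
  have hc2 := c2_pos hW hWm
  have e : ∀ {r : ℝ≥0}, r < 1 → (NNReal.sqrt (1 - r) : ℝ) = √(1 - (r : ℝ)) := fun {r} hr => by
    rw [Real.coe_sqrt, NNReal.coe_sub hr.le]; rfl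
  have h := bridgeValue_le_add hW hWm (sqrt_one_sub_le_one s) (NNReal.sqrt (1 - t)) x
  have hfin := bridgeValue_ne_top hW hWm (sqrt_one_sub_le_one t) x
  have h' := ENNReal.toReal_mono (ENNReal.add_ne_top.2 ⟨hfin, ENNReal.ofReal_ne_top⟩) h
  rw [ENNReal.toReal_add hfin ENNReal.ofReal_ne_top, ENNReal.toReal_ofReal (by positivity),
    e hs, e ht] at h'
  rw [value_eq hW hs, value_eq hW ht]
  linarith

theorem abs_sqrt_sub_le {s t T : ℝ} (hst : s ≤ t) (htT : t ≤ T) (hT : T < 1) :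
    |√(1 - t) - √(1 - s)| ≤ (t - s) / (2 * √(1 - T)) := by
  have h0 : 0 < √(1 - T) := Real.sqrt_pos.2 (by linarith)
  have h1 : √(1 - T) ≤ √(1 - t) := Real.sqrt_le_sqrt (by linarith)
  have h2 : √(1 - t) ≤ √(1 - s) := Real.sqrt_le_sqrt (by linarith)
  have h3 := Real.sq_sqrt (by linarith : 0 ≤ 1 - t)
  have h4 := Real.sq_sqrt (by linarith : 0 ≤ 1 - s)
  rw [abs_sub_comm, abs_of_nonneg (by linarith), le_div_iff₀ (by positivity)]
  nlinarith

theorem value_le (hW : IsBrownianReal W P) {t : ℝ≥0} (ht : t < 1) (x : ℝ) :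
    value P W hWm t x ≤ Real.exp |x| + √(1 - (t : ℝ)) * Real.exp |x| * c2 P W := by
  have hc2 := c2_pos hW hWm
  rw [value_eq hW ht]
  have h := bridgeValue_le hW hWm (sqrt_one_sub_le_one t) x
  rw [Real.coe_sqrt, NNReal.coe_sub ht.le] at h
  exact ENNReal.toReal_le_of_le_ofReal (by positivity) h

end Value

end BridgeStopping

/-! ### The main theorem. -/

theorem mainTheorem7 {Ω : Type*} [mΩ : MeasurableSpace Ω] (P : Measure Ω) [IsProbabilityMeasure P]
    (W : ℝ≥0 → Ω → ℝ) (hWm : ∀ t, Measurable (W t)) (hW : IsBrownianReal W P) :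
    -- the stopping problem and the constant are well defined
    (∀ t : ℝ≥0, t ≤ 1 → ∀ x : ℝ,
      (∀ τ : Ω → ℝ≥0, BridgeStopping.IsAdmissible P W hWm t τ →
        Integrable (BridgeStopping.payoff W t x τ) P) ∧
      (BridgeStopping.expectedPayoffs P W hWm t x).Nonempty ∧
      BddAbove (BridgeStopping.expectedPayoffs P W hWm t x)) ∧
    Integrable (fun ω => BridgeStopping.runningSup W ω *
      Real.exp (BridgeStopping.runningSup W ω)) P ∧
    0 < BridgeStopping.c2 P W ∧
    -- Lipschitz bound in time
    (∀ T : ℝ≥0, T < 1 → ∀ t₁ t₂ : ℝ≥0, t₁ < t₂ → t₂ ≤ T → ∀ x : ℝ,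
      |BridgeStopping.value P W hWm t₂ x - BridgeStopping.value P W hWm t₁ x| ≤
        BridgeStopping.c2 P W * Real.exp |x| / (2 * Real.sqrt (1 - (T : ℝ))) *
          ((t₂ : ℝ) - (t₁ : ℝ))) ∧
    -- behaviour as `t → 1`
    (∀ x : ℝ, BridgeStopping.value P W hWm 1 x = Real.exp x) ∧
    (∀ x : ℝ, 0 ≤ x →
      Tendsto (fun t : ℝ≥0 => BridgeStopping.value P W hWm t x) (𝓝[<] 1) (𝓝 (Real.exp x))) ∧
    (∀ x : ℝ, x < 0 →
      (1 : EReal) ≤ liminf (fun t : ℝ≥0 => (BridgeStopping.value P W hWm t x : EReal)) (𝓝[<] 1) ∧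
      Real.exp x < 1 ∧
      ¬ ContinuousWithinAt (fun t : ℝ≥0 => BridgeStopping.value P W hWm t x) (Set.Icc 0 1) 1) := by
  have hc2 := BridgeStopping.c2_pos hW hWm
  have hone : ∀ x, BridgeStopping.value P W hWm 1 x = Real.exp x := fun x => by
    rw [BridgeStopping.value, BridgeStopping.expectedPayoffs_one, csSup_singleton]
  refine ⟨fun t ht x => ⟨fun τ hτ => ?_, BridgeStopping.expectedPayoffs_nonempty ht x, ?_⟩,
    ?_, hc2, fun T hT t₁ t₂ h12 h2T x => ?_, hone, fun x hx => ?_, fun x hx => ?_⟩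
  · rcases ht.eq_or_lt with rfl | h
    · rw [hτ.eq_zero]
      simp only [funext (BridgeStopping.payoff_zero 1 x)]
      exact integrable_const _
    · exact hτ.integrable hW h x
  · rcases ht.eq_or_lt with rfl | h
    · rw [BridgeStopping.expectedPayoffs_one]; exact bddAbove_singleton
    · exact (BridgeStopping.isLUB_expectedPayoffs hW h x).bddAbove
  · simpa only [BridgeStopping.absMulExp_runningSup] using
      BridgeStopping.integrable_runningSup hW hWm
  · have h2 := h2T.trans_lt hT
    have h1 := h12.trans h2
    have hb := BridgeStopping.abs_sqrt_sub_le (NNReal.coe_le_coe.2 h12.le)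
      (NNReal.coe_le_coe.2 h2T) (by exact_mod_cast hT)
    have hfin : |√(1 - (t₂ : ℝ)) - √(1 - (t₁ : ℝ))| * Real.exp |x| * BridgeStopping.c2 P W ≤
        BridgeStopping.c2 P W * Real.exp |x| / (2 * √(1 - (T : ℝ))) * ((t₂ : ℝ) - t₁) := by
      calc _ ≤ ((t₂ : ℝ) - t₁) / (2 * √(1 - (T : ℝ))) * Real.exp |x| *
            BridgeStopping.c2 P W := by gcongr
        _ = _ := by ring
    refine (abs_sub_le_iff.2 ⟨BridgeStopping.value_sub_le hW h2 h1 x, ?_⟩).trans hfin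
    rw [abs_sub_comm]
    exact BridgeStopping.value_sub_le hW h1 h2 x
  · have hlt : ∀ᶠ t : ℝ≥0 in 𝓝[<] 1, t < 1 := self_mem_nhdsWithin
    have hlim : Tendsto (fun t : ℝ≥0 => Real.exp |x| +
        √(1 - (t : ℝ)) * Real.exp |x| * BridgeStopping.c2 P W) (𝓝[<] 1) (𝓝 (Real.exp x)) := by
      have : Continuous fun t : ℝ≥0 => Real.exp |x| +
        √(1 - (t : ℝ)) * Real.exp |x| * BridgeStopping.c2 P W := by fun_prop
      have h := (this.tendsto 1).mono_left (nhdsWithin_le_nhds (s := Set.Iio 1))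
      simpa [abs_of_nonneg hx] using h
    refine tendsto_of_tendsto_of_tendsto_of_le_of_le' tendsto_const_nhds hlim ?_ ?_
    · filter_upwards [hlt] with t ht using BridgeStopping.exp_le_value hW ht x
    · filter_upwards [hlt] with t ht using BridgeStopping.value_le hW ht x
  · have hlt : ∀ᶠ t : ℝ≥0 in 𝓝[<] 1, t < 1 := self_mem_nhdsWithin
    have hge : ∀ᶠ t : ℝ≥0 in 𝓝[<] 1, 1 ≤ BridgeStopping.value P W hWm t x :=
      hlt.mono fun t ht => BridgeStopping.one_le_value hW ht x
    have hx1 : Real.exp x < 1 := Real.exp_lt_one_iff.2 hx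
    refine ⟨le_liminf_of_le (by isBoundedDefault) (hge.mono fun t ht => by exact_mod_cast ht),
      hx1, fun hcont => ?_⟩
    have : (𝓝[<] (1 : ℝ≥0)).NeBot := nhdsLT_neBot_of_exists_lt ⟨0, one_pos⟩
    have hlim : Tendsto (fun t : ℝ≥0 => BridgeStopping.value P W hWm t x) (𝓝[<] 1)
        (𝓝 (BridgeStopping.value P W hWm 1 x)) := by
      refine hcont.tendsto.mono_left (nhdsWithin_mono _ fun t ht => ⟨zero_le, ht.le⟩)
    rw [hone] at hlim
    -- Continuity at `1` would force `e^x ≥ 1`, against `x < 0`.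
    exact absurd (ge_of_tendsto hlim hge) (not_le.2 hx1)
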